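/- Fix integers $n\ge 3$ (number of voters), $m\ge 3$ (number of outcomes) and $0<k<m$, and a strict linear tie-break order $\succ_L$ on the set $O=\{o_1,\dots,o_m\}$ of outcomes. In the $k$-approval rule $f$, every voter reports a strict linear order on $O$ and gives one point to each of her $k$ most preferred outcomes; $f$ returns the outcome with the most points, ties being broken in favour of the outcome ranked highest by $\succ_L$. For a voter $i$ with true preference $\succ_i$ and a report $\succ_i'$, let $B_{\succ_i}(\succ_i',f)$ and $W_{\succ_i}(\succ_i',f)$ be the best and the worst outcome, with respect to $\succ_i$, that $f$ returns when $i$ reports $\succ_i'$, over all possible reports of the other voters. The obvious manipulation problem (OM) for $k$-approval is: given $n$, $m$, $k$, a voter $i$, her preference $\succ_i$ and the tie-break order $\succ_L$, find a preference $\succ_i'$ such that $W_{\succ_i}(\succ_i',f)\succ_i W_{\succ_i}(\succ_i,f)$ or $B_{\succ_i}(\succ_i',f)\succ_i B_{\succ_i}(\succ_i,f)$, or report that no such $\succ_i'$ exists. Then OM for $k$-approval can be solved in polynomial time: there is a deterministic (multi-stack) Turing machine that, on every instance, outputs a correct answer within a number of steps that is polynomial in the length of the input, where all numbers (including $n$ and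 $k$) are written in binary and the two orders are written as lists of outcomes. -/

import Mathlib

namespace ObviousManipulation

/-- A strict (linear) preference order over the outcomes `0, …, m - 1`, given as a ranking:
`r j` is the outcome in position `j`, position `0` being the most preferred one. -/
abbrev Ranking (m : ℕ) : Type := Equiv.Perm (Fin m)

/-- `Prefers r a b`: the outcome `a` is strictly preferred to the outcome `b` under `r`. -/
def Prefers {m : ℕ} (r : Ranking m) (a b : Fin m) : Prop := r.symm a < r.symm b

/-- A (resolute) voting rule for `n` voters and `m` outcomes. -/
abbrev VotingRule (n m : ℕ) : Type := (Fin n → Ranking m) → Fin m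

/-- Total score of the outcome `o` at the profile `P`: every voter gives `w j` points to the
outcome in position `j` of her ranking. -/
def score {n m : ℕ} (w : Fin m → ℕ) (P : Fin n → Ranking m) (o : Fin m) : ℕ :=
  ∑ i, w ((P i).symm o)

/-- The outcomes of maximal score. -/
def topScorers {n m : ℕ} (w : Fin m → ℕ) (P : Fin n → Ranking m) : Finset (Fin m) :=
  Finset.univ.filter fun o => ∀ o', score w P o' ≤ score w P o

theorem topScorers_nonempty {n m : ℕ} [NeZero m] (w : Fin m → ℕ) (P : Fin n → Ranking m) :
    (topScorers w P).Nonempty := by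
  obtain ⟨o, -, ho⟩ := Finset.exists_max_image Finset.univ (score w P)
    (Finset.univ_nonempty (α := Fin m))
  exact ⟨o, by simpa [topScorers] using ho⟩

/-- The positional scoring rule with score vector `w`; among the outcomes of maximal score it
returns the one that comes first in the fixed tie-break order `L`. -/
def scoringRule {n m : ℕ} [NeZero m] (w : Fin m → ℕ) (L : Ranking m) : VotingRule n m :=
  fun P => L (((topScorers w P).image L.symm).min' ((topScorers_nonempty w P).image _))

/-- The `k`-approval rule with tie-break order `L`: the scoring rule with score vector
`(1, …, 1, 0, …, 0)`, where there are `k` ones. -/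
def kApproval {n m : ℕ} [NeZero m] (k : ℕ) (L : Ranking m) : VotingRule n m :=
  scoringRule (fun j => if j.val < k then 1 else 0) L

/-- The outcomes that may result when voter `i` reports `r'`, over all possible reports of the
other voters. -/
def reachable {n m : ℕ} (f : VotingRule n m) (i : Fin n) (r' : Ranking m) : Finset (Fin m) :=
  Finset.univ.image fun P : Fin n → Ranking m => f (Function.update P i r')

theorem reachable_nonempty {n m : ℕ} (f : VotingRule n m) (i : Fin n) (r' : Ranking m) :
    (reachable f i r').Nonempty :=
  Finset.univ_nonempty.image _

/-- The best outcome with respect to `r` that may result when voter `i` reports `r'`. -/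
def bestOutcome {n m : ℕ} (f : VotingRule n m) (i : Fin n) (r r' : Ranking m) : Fin m :=
  r (((reachable f i r').image r.symm).min' ((reachable_nonempty f i r').image _))

/-- The worst outcome with respect to `r` that may result when voter `i` reports `r'`. -/
def worstOutcome {n m : ℕ} (f : VotingRule n m) (i : Fin n) (r r' : Ranking m) : Fin m :=
  r (((reachable f i r').image r.symm).max' ((reachable_nonempty f i r').image _))

/-- For voter `i` with true preference `r`, the report `r'` is an obvious manipulation: it
strictly improves the worst case or the best case, compared with the truthful report. -/
def IsObviousManipulation {n m : ℕ} (f : VotingRule n m) (i : Fin n) (r r' : Ranking m) : Prop :=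
  Prefers r (worstOutcome f i r r') (worstOutcome f i r r) ∨
    Prefers r (bestOutcome f i r r') (bestOutcome f i r r)

/-- An instance of the obvious manipulation problem for approval rules. -/
structure OMInstance where
  /-- number of voters -/
  n : ℕ
  /-- number of outcomes -/
  m : ℕ
  /-- number of approved outcomes: the voting rule is `k`-approval -/
  k : ℕ
  three_le_n : 3 ≤ n
  three_le_m : 3 ≤ m
  k_pos : 0 < k
  k_lt_m : k < m
  /-- the manipulating voter -/
  voter : Fin n
  /-- her true preference -/
  pref : Ranking m
  /-- the fixed tie-break order -/
  tieBreak : Ranking m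

instance (x : OMInstance) : NeZero x.m := ⟨by have := x.three_le_m; omega⟩

/-- The voting rule of an instance. -/
def OMInstance.rule (x : OMInstance) : VotingRule x.n x.m := kApproval x.k x.tieBreak

/-- The outcomes listed from the first to the last position of a ranking. -/
def Ranking.toList {m : ℕ} (r : Ranking m) : List ℕ := List.ofFn fun j => (r j).val

/-- A correct answer for the instance `x`: an obvious manipulation, written as a list of outcomes,
or `none` if there is no obvious manipulation. -/
def IsAnswer (x : OMInstance) : Option (List ℕ) → Prop
  | some l => ∃ r' : Ranking x.m,
      l = Ranking.toList r' ∧ IsObviousManipulation x.rule x.voter x.pref r'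
  | none => ∀ r' : Ranking x.m, ¬ IsObviousManipulation x.rule x.voter x.pref r'

open Computability in
/-- A natural number in binary, closed by a comma. -/
def encodeNumber (a : ℕ) : List Γ' := (encodeNat a).map Γ'.bit ++ [Γ'.comma]

open Computability in
/-- A list of natural numbers, all in binary, closed by a bracket. -/
def encodeNumbers (l : List ℕ) : List Γ' := l.flatMap encodeNumber ++ [Γ'.ket]

open Computability in
/-- The input word of an instance; all numbers are written in binary. -/
def encodeInstance (x : OMInstance) : List Γ' :=
  encodeNumber x.n ++ encodeNumber x.m ++ encodeNumber x.k ++ encodeNumber x.voter.val ++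
    encodeNumbers (Ranking.toList x.pref) ++ encodeNumbers (Ranking.toList x.tieBreak)

open Computability in
/-- The output word of an answer: the empty word for `none`. -/
def encodeAnswer : Option (List ℕ) → List Γ'
  | some l => encodeNumbers l
  | none => []

end ObviousManipulation

/-! Each of the other n-1 voters withholds her point from m-k outcomes. For o to win against a fixed
report, a competitor d must be omitted at least [d approved] + [d ahead of o in the tie-break order]
- [o approved] times (truncated at 0), and omitting o itself never helps. Every demand is at most 2
≤ n-1, so by `exists_cover` the demands can be met iff their sum is at most D = (n-1)(m-k); this is
`mem_reachable_iff`. Hence an approved o is reachable iff at most D approved outcomes precede it in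
the tie-break order, and an omitted o iff k plus its tie-break position is at most D.

If m ≤ n(m-k), that is k ≤ D, all approved outcomes are reachable and reachability of an omitted
outcome does not depend on the report, so nothing can be gained (`not_isObviousManipulation_of_le`).
Otherwise D < k, only approved outcomes are reachable, and all of them lie in the front, the first
n(m-k)+1 outcomes of the tie-break order. Let X consist of the m-k outcomes of the front that the
manipulator likes least. Omitting X restricts the result to the remaining D+1 outcomes of the front,
and no report guarantees more. Truth-telling already achieves this unless some x in X that is
truthfully approved precedes, in the tie-break order, some y of the front outside X. So an obvious
manipulation exists iff there is such an inversion, and then every report that omits exactly X is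
one (`isObviousManipulation_of_isOmission`, `not_isObviousManipulation_of_isOmission`).

This criterion is evaluated by an explicit program over finitely many stacks. A structured language
with a step-counting semantics is compiled to multi-stack machines (`Exec.stepsTo`), so the running
time can be bounded program by program; the total is quadratic in the input length (`run_main`).
Binary n does no harm because the loop over n stops once the tie-break list is used up; binary k is
smaller than m, which is at most the length of the input. `isAnswer_answer` joins the two halves. -/

open Computability

/-! ### A structured stack language and its compilation to multi-stack machines. -/

namespace StackProgram

set_option linter.constructorNameAsVariable false

/-- Programs over finitely many stacks of symbols. -/
inductive Prog (K : Type) : Type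
  | skip : Prog K
  | push (k : K) (a : Γ') : Prog K
  | seq (p q : Prog K) : Prog K
  /-- pop a symbol and continue with the program chosen by it -/
  | pop (k : K) (f : Option Γ' → Prog K) : Prog K
  /-- branch on the top symbol, which stays on the stack -/
  | ite (k : K) (c : Option Γ' → Bool) (p q : Prog K) : Prog K
  | while (k : K) (c : Option Γ' → Bool) (p : Prog K) : Prog K

namespace Prog

variable {K : Type}

/-- The control points of a program. -/
def Label : Prog K → Type
  | skip => Unit
  | push _ _ => Unit
  | seq p q => p.Label ⊕ q.Label
  | pop _ f => Unit ⊕ (Σ o, (f o).Label)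
  | ite _ _ p q => Unit ⊕ (p.Label ⊕ q.Label)
  | .while _ _ p => Unit ⊕ p.Label

theorem finite_label : (p : Prog K) → Finite p.Label
  | skip => inferInstanceAs (Finite Unit)
  | push _ _ => inferInstanceAs (Finite Unit)
  | seq p q =>
    have := p.finite_label; have := q.finite_label
    inferInstanceAs (Finite (p.Label ⊕ q.Label))
  | pop _ f =>
    have := fun o => (f o).finite_label
    inferInstanceAs (Finite (Unit ⊕ (Σ o, (f o).Label)))
  | ite _ _ p q =>
    have := p.finite_label; have := q.finite_label
    inferInstanceAs (Finite (Unit ⊕ (p.Label ⊕ q.Label)))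
  | .while _ _ p =>
    have := p.finite_label
    inferInstanceAs (Finite (Unit ⊕ p.Label))

def entry : (p : Prog K) → p.Label
  | skip => ()
  | push _ _ => ()
  | seq p _ => .inl p.entry
  | pop _ _ => .inl ()
  | ite _ _ _ _ => .inl ()
  | .while _ _ _ => .inl ()

/-- The machine statements of a program whose control points are embedded by `e` in a larger
set of labels and which continues at `x`. -/
def code {Λ : Type} : (p : Prog K) → (p.Label → Λ) → Λ → p.Label →
    Turing.TM2.Stmt (fun _ : K => Γ') Λ (Option Γ')
  | skip, _, x, _ => .goto fun _ => x
  | push k a, _, x, _ => .push k (fun _ => a) (.goto fun _ => x)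
  | seq p q, e, _, .inl l => p.code (fun l => e (.inl l)) (e (.inr q.entry)) l
  | seq _ q, e, x, .inr l => q.code (fun l => e (.inr l)) x l
  | pop k f, e, _, .inl _ => .pop k (fun _ o => o) (.goto fun o => e (.inr ⟨o, (f o).entry⟩))
  | pop _ f, e, x, .inr ⟨o, l⟩ => (f o).code (fun l => e (.inr ⟨o, l⟩)) x l
  | ite k c p q, e, _, .inl _ => .peek k (fun _ o => o)
      (.branch c (.goto fun _ => e (.inr (.inl p.entry))) (.goto fun _ => e (.inr (.inr q.entry))))
  | ite _ _ p _, e, x, .inr (.inl l) => p.code (fun l => e (.inr (.inl l))) x l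
  | ite _ _ _ q, e, x, .inr (.inr l) => q.code (fun l => e (.inr (.inr l))) x l
  | .while k c p, e, x, .inl _ => .peek k (fun _ o => o)
      (.branch c (.goto fun _ => e (.inr p.entry)) (.goto fun _ => x))
  | .while _ _ p, e, _, .inr l => p.code (fun l => e (.inr l)) (e (.inl ())) l

end Prog

/-! ### Step-counting semantics and its simulation by the machine. -/

section Semantics

variable {K : Type} [DecidableEq K]

open Prog Function

/-- `Exec p s t s'`: started on the stacks `s`, the program `p` ends after `t` steps on the
stacks `s'`. -/
inductive Exec : Prog K → (K → List Γ') → ℕ → (K → List Γ') → Prop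
  | skip (s) : Exec .skip s 1 s
  | push (s k a) : Exec (.push k a) s 1 (update s k (a :: s k))
  | seq {p q s t s' t' s''} : Exec p s t s' → Exec q s' t' s'' → Exec (.seq p q) s (t + t') s''
  | pop {k f s t s'} : Exec (f (s k).head?) (update s k (s k).tail) t s' →
      Exec (.pop k f) s (t + 1) s'
  | ite_true {k c p q s t s'} : c (s k).head? = true → Exec p s t s' →
      Exec (.ite k c p q) s (t + 1) s'
  | ite_false {k c p q s t s'} : c (s k).head? = false → Exec q s t s' →
      Exec (.ite k c p q) s (t + 1) s'
  | while_false {k c p s} : c (s k).head? = false → Exec (.while k c p) s 1 s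
  | while_true {k c p s t s' t' s''} : c (s k).head? = true → Exec p s t s' →
      Exec (.while k c p) s' t' s'' → Exec (.while k c p) s (t + t' + 1) s''

variable {Λ : Type}

/-- The machine `M` goes from the label `l` with stacks `s` to the label `l'` with stacks `s'`
in `t` steps, whatever its internal state is. -/
def StepsTo (M : Λ → Turing.TM2.Stmt (fun _ : K => Γ') Λ (Option Γ')) (t : ℕ)
    (l : Λ) (s : K → List Γ') (l' : Λ) (s' : K → List Γ') : Prop :=
  ∀ v, ∃ v', (flip Option.bind (Turing.TM2.step M))^[t] (some ⟨some l, v, s⟩) =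
    some ⟨some l', v', s'⟩

variable {M : Λ → Turing.TM2.Stmt (fun _ : K => Γ') Λ (Option Γ')}

theorem StepsTo.trans {t t' l s l' s' l'' s''} (h : StepsTo M t l s l' s')
    (h' : StepsTo M t' l' s' l'' s'') : StepsTo M (t + t') l s l'' s'' := by
  intro v
  obtain ⟨v', hv'⟩ := h v
  obtain ⟨v'', hv''⟩ := h' v'
  exact ⟨v'', by rw [add_comm, iterate_add_apply, hv', hv'']⟩

theorem stepsTo_one {l s l' s'}
    (h : ∀ v, ∃ v', Turing.TM2.stepAux (M l) v s = ⟨some l', v', s'⟩) :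
    StepsTo M 1 l s l' s' := by
  intro v
  obtain ⟨v', hv'⟩ := h v
  exact ⟨v', by simp [flip, Turing.TM2.step, hv']⟩

/-- Every control point carries a statement that ends in a jump, so it costs exactly one machine
step, the unit counted by `Exec`. The embedding `e` and the exit `x` stay arbitrary so that the
induction hypothesis applies to subprograms; tests and pops overwrite the internal state before
using it. -/
theorem Exec.stepsTo {p : Prog K} {s : K → List Γ'} {t : ℕ} {s' : K → List Γ'}
    (h : Exec p s t s') : ∀ (e : p.Label → Λ) (x : Λ), (∀ l, M (e l) = p.code e x l) →
      StepsTo M t (e p.entry) s x s' := by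
  induction h with
  | skip s => exact fun e x hM => stepsTo_one fun v => ⟨v, by rw [hM]; rfl⟩
  | push s k a => exact fun e x hM => stepsTo_one fun v => ⟨v, by rw [hM]; rfl⟩
  | seq _ _ ih ih' =>
    exact fun e x hM => (ih _ _ fun l => hM (.inl l)).trans (ih' (fun l => e (.inr l)) _ fun l => hM (.inr l))
  | @pop k f s t s' _ ih =>
    intro e x hM
    rw [add_comm]
    exact (stepsTo_one fun v => ⟨(s k).head?, by rw [hM]; rfl⟩).trans
      (ih (fun l => e (.inr ⟨_, l⟩)) x fun l => hM (.inr ⟨_, l⟩))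
  | @ite_true k c p q s t s' hc _ ih =>
    intro e x hM
    rw [add_comm]
    exact (stepsTo_one fun v => ⟨(s k).head?, by
      rw [hM]; simp only [code, entry, Turing.TM2.stepAux, hc]; rfl⟩).trans
      (ih (fun l => e (.inr (.inl l))) x fun l => hM (.inr (.inl l)))
  | @ite_false k c p q s t s' hc _ ih =>
    intro e x hM
    rw [add_comm]
    exact (stepsTo_one fun v => ⟨(s k).head?, by
      rw [hM]; simp only [code, entry, Turing.TM2.stepAux, hc]; rfl⟩).trans
      (ih (fun l => e (.inr (.inr l))) x fun l => hM (.inr (.inr l)))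
  | @while_false k c p s hc =>
    exact fun e x hM => stepsTo_one fun v => ⟨(s k).head?, by
      rw [hM]; simp only [code, entry, Turing.TM2.stepAux, hc]; rfl⟩
  | @while_true k c p s t s' t' s'' hc _ _ ih ih' =>
    intro e x hM
    rw [add_comm]
    refine (stepsTo_one fun v => ⟨(s k).head?, by
      rw [hM]; simp only [code, entry, Turing.TM2.stepAux, hc]; rfl⟩).trans
      ((ih (fun l => e (.inr l)) (e (.inl ())) fun l => hM (.inr l)).trans (ih' e x hM))

end Semantics

/-- The machine that executes a program, with input stack `i` and output stack `o`. -/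
noncomputable def machine {K : Type} [DecidableEq K] [Fintype K] (p : Prog K) (i o : K) :
    Turing.FinTM2 where
  K := K
  k₀ := i
  k₁ := o
  Γ _ := Γ'
  Λ := Option p.Label
  main := some p.entry
  ΛFin := have := p.finite_label; Fintype.ofFinite _
  σ := Option Γ'
  initialState := none
  Γk₀Fin := inferInstanceAs (Fintype Γ')
  m
    -- The exit label restores the initial internal state, as the prescribed halting configuration
    -- demands. It costs one extra step.
    | none => .load (fun _ => none) .halt
    | some l => p.code some none l

/-- The halting configuration has every stack empty except the output, hence the exact form of the
final stacks in `h`; the summand 1 pays for the halting step. -/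
theorem nonempty_tm2ComputableInPolyTime {K : Type} [DecidableEq K] [Fintype K] (p : Prog K)
    (i o : K) {α β : Type} (ea : α → List Γ') (eb : β → List Γ') (f : α → β)
    (time : Polynomial ℕ)
    (h : ∀ a, ∃ t, t + 1 ≤ time.eval (ea a).length ∧
      Exec p (Function.update (fun _ => []) i (ea a)) t
        (Function.update (fun _ => []) o (eb (f a)))) :
    Nonempty (Turing.TM2ComputableInPolyTime ea eb f) := by
  choose t ht hexec using h
  refine ⟨{ tm := machine p i o, inputAlphabet := Equiv.refl _, outputAlphabet := Equiv.refl _,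
            time := time, outputsFun := fun a => ⟨⟨t a + 1, ?_⟩, ht a⟩ }⟩
  have key : StepsTo (machine p i o).m (t a) (some p.entry)
      (Function.update (fun _ => []) i (ea a)) none (Function.update (fun _ => []) o (eb (f a))) :=
    (hexec a).stepsTo some none fun _ => rfl
  obtain ⟨v', hv'⟩ := key none
  have h0 : Turing.initList (machine p i o) (ea a) =
      ⟨some (some p.entry), none, Function.update (fun _ => []) i (ea a)⟩ := by
    unfold Turing.initList
    congr 1
    refine funext fun (k : K) => ?_
    by_cases hk : k = i
    · subst hk
      exact (dif_pos rfl).trans (Function.update_self (β := fun _ => List Γ') _ _ _).symm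
    · exact (dif_neg hk).trans (Function.update_of_ne (β := fun _ => List Γ') hk _ fun _ => []).symm
  have h1 : Turing.haltList (machine p i o) (eb (f a)) =
      ⟨none, none, Function.update (fun _ => []) o (eb (f a))⟩ := by
    unfold Turing.haltList
    congr 1
    refine funext fun (k : K) => ?_
    by_cases hk : k = o
    · subst hk
      exact (dif_pos rfl).trans (Function.update_self (β := fun _ => List Γ') _ _ _).symm
    · exact (dif_neg hk).trans (Function.update_of_ne (β := fun _ => List Γ') hk _ fun _ => []).symm
  have e1 : List.map (Equiv.refl Γ').invFun (ea a) = ea a := List.map_id _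
  have e2 : List.map (Equiv.refl Γ').invFun (eb (f a)) = eb (f a) := List.map_id _
  have := (Function.iterate_succ_apply' (flip Option.bind (Turing.TM2.step (machine p i o).m)) (t a)
    (some ⟨some (some p.entry), none, Function.update (fun _ => []) i (ea a)⟩)).trans
      (congrArg (flip Option.bind (Turing.TM2.step (machine p i o).m)) hv')
  refine (congrArg (fun c => (flip Option.bind (machine p i o).step)^[t a + 1] (some c))
    ((congrArg _ e1).trans h0)).trans (Eq.trans this ?_)
  exact congrArg some (((congrArg _ e2).trans h1).symm)

/-! ### Named stacks and rules for running times. -/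

/-- The stacks of the program: the input; the preference, worst outcome first; the numbers of
voters and of approvals in binary; the number of omitted outcomes in unary, twice; the front part
of the tie-break order; its part already scanned; the current outcome; two auxiliary stacks; two
flags; the outcomes to be approved; the output. -/
inductive Reg
  | i | p | n | b | c | d | q | r | w | u | v | e | f | s | o
  deriving DecidableEq

instance : Fintype Reg :=
  ⟨{.i, .p, .n, .b, .c, .d, .q, .r, .w, .u, .v, .e, .f, .s, .o}, by intro k; cases k <;> decide⟩

/-- The contents of all stacks. -/
@[ext]
structure Stacks where
  (i p n b c d q r w u v e f s o : List Γ')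

namespace Stacks

def get (σ : Stacks) : Reg → List Γ'
  | .i => σ.i | .p => σ.p | .n => σ.n | .b => σ.b | .c => σ.c | .d => σ.d | .q => σ.q | .r => σ.r
  | .w => σ.w | .u => σ.u | .v => σ.v | .e => σ.e | .f => σ.f | .s => σ.s | .o => σ.o

def set (σ : Stacks) (k : Reg) (l : List Γ') : Stacks :=
  match k with
  | .i => { σ with i := l } | .p => { σ with p := l } | .n => { σ with n := l }
  | .b => { σ with b := l } | .c => { σ with c := l } | .d => { σ with d := l }
  | .q => { σ with q := l } | .r => { σ with r := l } | .w => { σ with w := l }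
  | .u => { σ with u := l } | .v => { σ with v := l } | .e => { σ with e := l }
  | .f => { σ with f := l } | .s => { σ with s := l } | .o => { σ with o := l }

theorem get_injective : Function.Injective get := by
  intro σ τ h
  have := fun k => congrFun h k
  ext1
  exacts [this .i, this .p, this .n, this .b, this .c, this .d, this .q, this .r, this .w, this .u,
    this .v, this .e, this .f, this .s, this .o]

theorem get_set (σ : Stacks) (k : Reg) (l : List Γ') :
    (σ.set k l).get = Function.update σ.get k l := by
  funext k'
  by_cases h : k' = k
  · subst h; rw [Function.update_self]; cases k' <;> rfl
  · rw [Function.update_of_ne h]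
    cases k <;> cases k' <;> first | rfl | exact absurd rfl h

@[simp] theorem get_set_self (σ : Stacks) (k : Reg) (l : List Γ') : (σ.set k l).get k = l := by
  rw [get_set, Function.update_self]

theorem get_set_of_ne (σ : Stacks) {k k' : Reg} (h : k' ≠ k) (l : List Γ') :
    (σ.set k l).get k' = σ.get k' := by
  rw [get_set, Function.update_of_ne h]

@[simp] theorem set_set (σ : Stacks) (k : Reg) (l l' : List Γ') :
    (σ.set k l).set k l' = σ.set k l' := by
  apply get_injective; simp [get_set]

theorem set_comm (σ : Stacks) {k k' : Reg} (h : k' ≠ k) (l l' : List Γ') :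
    (σ.set k l).set k' l' = (σ.set k' l').set k l := by
  apply get_injective; simp [get_set, Function.update_comm h]

@[simp] theorem set_get (σ : Stacks) (k : Reg) : σ.set k (σ.get k) = σ := by
  apply get_injective; simp [get_set]

theorem set_eq_self {σ : Stacks} {k : Reg} {l : List Γ'} (h : σ.get k = l) : σ.set k l = σ := by
  rw [← h, set_get]

end Stacks

/-- `Run p σ T τ`: the program `p` leads from `σ` to `τ` in at most `T` steps. -/
def Run (p : Prog Reg) (σ : Stacks) (T : ℕ) (τ : Stacks) : Prop :=
  ∃ t ≤ T, Exec p σ.get t τ.get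

namespace Run

variable {p q : Prog Reg} {σ τ ρ : Stacks} {T T' : ℕ} {k : Reg} {a : Γ'} {l : List Γ'}
  {f : Option Γ' → Prog Reg} {c : Option Γ' → Bool}

theorem mono (h : Run p σ T τ) (hT : T ≤ T') : Run p σ T' τ :=
  let ⟨t, ht, h⟩ := h; ⟨t, ht.trans hT, h⟩

theorem congr {τ' : Stacks} (h : Run p σ T τ) (hT : T ≤ T') (hτ : τ = τ') : Run p σ T' τ' :=
  hτ ▸ h.mono hT

theorem skip (σ) : Run .skip σ 1 σ := ⟨1, le_rfl, .skip _⟩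

theorem push (σ : Stacks) (k a) : Run (.push k a) σ 1 (σ.set k (a :: σ.get k)) :=
  ⟨1, le_rfl, by rw [Stacks.get_set]; exact .push _ _ _⟩

theorem seq (h : Run p σ T τ) (h' : Run q τ T' ρ) : Run (.seq p q) σ (T + T') ρ :=
  let ⟨t, ht, h⟩ := h; let ⟨t', ht', h'⟩ := h'; ⟨t + t', add_le_add ht ht', h.seq h'⟩

theorem pop_nil (hk : σ.get k = []) (h : Run (f none) σ T τ) : Run (.pop k f) σ (T + 1) τ := by
  obtain ⟨t, ht, h⟩ := h
  refine ⟨t + 1, by omega, .pop ?_⟩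
  rwa [hk, List.tail_nil, ← hk, Function.update_eq_self, hk]

theorem pop_cons (hk : σ.get k = a :: l) (h : Run (f (some a)) (σ.set k l) T τ) :
    Run (.pop k f) σ (T + 1) τ := by
  obtain ⟨t, ht, h⟩ := h
  refine ⟨t + 1, by omega, .pop ?_⟩
  rwa [hk, List.tail_cons, ← Stacks.get_set]

theorem ite_true (hc : c (σ.get k).head? = true) (h : Run p σ T τ) :
    Run (.ite k c p q) σ (T + 1) τ :=
  let ⟨t, ht, h⟩ := h; ⟨t + 1, by omega, .ite_true hc h⟩

theorem ite_false (hc : c (σ.get k).head? = false) (h : Run q σ T τ) :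
    Run (.ite k c p q) σ (T + 1) τ :=
  let ⟨t, ht, h⟩ := h; ⟨t + 1, by omega, .ite_false hc h⟩

theorem while_false (hc : c (σ.get k).head? = false) : Run (.while k c p) σ 1 σ :=
  ⟨1, le_rfl, .while_false hc⟩

theorem while_true (hc : c (σ.get k).head? = true) (h : Run p σ T τ)
    (h' : Run (.while k c p) τ T' ρ) : Run (.while k c p) σ (T + T' + 1) ρ :=
  let ⟨t, ht, h⟩ := h; let ⟨t', ht', h'⟩ := h'; ⟨t + t' + 1, by omega, .while_true hc h h'⟩

end Run

/-! ### Moving symbols and words between stacks. -/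

open Prog

/-- Remove the top symbol of a stack. -/
def drop (a : Reg) : Prog Reg := .pop a fun _ => skip

theorem run_drop (a : Reg) (σ : Stacks) : Run (drop a) σ 2 (σ.set a (σ.get a).tail) := by
  cases h : σ.get a with
  | nil => rw [List.tail_nil, Stacks.set_eq_self h]; exact .pop_nil h (.skip _)
  | cons x l => exact .pop_cons h (.skip _)

/-- Remove all symbols of a stack. -/
def clear (a : Reg) : Prog Reg := .while a Option.isSome (drop a)

theorem run_clear (a : Reg) (σ : Stacks) : Run (clear a) σ (3 * (σ.get a).length + 1) (σ.set a []) := by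
  generalize h : σ.get a = l
  induction l generalizing σ with
  | nil => rw [Stacks.set_eq_self h]; exact .while_false (by rw [h]; rfl)
  | cons x l ih =>
    have h1 := run_drop a σ
    rw [h, List.tail_cons] at h1
    have h2 := ih (σ.set a l) (by simp)
    rw [Stacks.set_set] at h2
    exact (Run.while_true (by rw [h]; rfl) h1 h2).mono (by rw [List.length_cons]; omega)

/-- Move the top symbol of the stack `a` to the stack `b`. -/
def moveSymbol (a b : Reg) : Prog Reg :=
  .pop a fun
    | some x => .push b x
    | none => skip

theorem run_moveSymbol {a b : Reg} (hab : b ≠ a) {σ : Stacks} {x l} (h : σ.get a = x :: l) :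
    Run (moveSymbol a b) σ 2 ((σ.set a l).set b (x :: σ.get b)) := by
  refine .pop_cons h ?_
  have := Run.push (σ.set a l) b x
  rwa [Stacks.get_set_of_ne _ hab] at this

/-- Move symbols from the stack `a` to the stack `b` as long as the top symbol satisfies `c`. -/
def moveWhile (a b : Reg) (c : Option Γ' → Bool) : Prog Reg := .while a c (moveSymbol a b)

theorem run_moveWhile {a b : Reg} (hab : b ≠ a) {c : Option Γ' → Bool} (l x : List Γ')
    (hl : ∀ y ∈ l, c (some y) = true) (hx : c x.head? = false) {σ : Stacks}
    (h : σ.get a = l ++ x) :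
    Run (moveWhile a b c) σ (3 * l.length + 1)
      ((σ.set a x).set b (l.reverse ++ σ.get b)) := by
  induction l generalizing σ with
  | nil =>
    rw [List.nil_append] at h
    rw [Stacks.set_eq_self h, List.reverse_nil, List.nil_append, Stacks.set_get]
    exact .while_false (by rw [h, hx])
  | cons y l ih =>
    have h2 := ih (fun z hz => hl z (List.mem_cons_of_mem _ hz))
      (σ := (σ.set a (l ++ x)).set b (y :: σ.get b)) (by
        rw [Stacks.get_set_of_ne _ hab.symm, Stacks.get_set_self])
    rw [Stacks.get_set_self, Stacks.set_comm _ hab.symm, Stacks.set_set, Stacks.set_set] at h2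
    rw [List.reverse_cons, List.append_assoc, List.singleton_append]
    exact (Run.while_true (by rw [h]; exact hl y List.mem_cons_self)
      (run_moveSymbol hab h) h2).mono (by rw [List.length_cons]; omega)

def isBit : Option Γ' → Bool
  | some (.bit _) => true
  | _ => false

/-- Move a stack on top of another one, reversing it. -/
def drain (a b : Reg) : Prog Reg := moveWhile a b Option.isSome

theorem run_drain {a b : Reg} (hab : b ≠ a) (σ : Stacks) :
    Run (drain a b) σ (3 * (σ.get a).length + 1)
      ((σ.set a []).set b ((σ.get a).reverse ++ σ.get b)) :=
  run_moveWhile hab _ [] (fun _ _ => rfl) rfl (List.append_nil _).symm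

/-- Move a word of bits, using the stack `u`; the symbol after the word goes to `g`. -/
def moveBits (a b : Reg) (g : Option Γ' → Prog Reg) : Prog Reg :=
  .seq (moveWhile a .u isBit) (.seq (.pop a g) (drain .u b))

/-- Two reversals, through `u`, keep the bits of the word in order. The continuation `g` runs while
the word lies reversed on `u`, so `τ` records its effect on the other stacks. -/
theorem run_moveBits {a b : Reg} (ha : .u ≠ a) (hb : .u ≠ b) {g : Option Γ' → Prog Reg}
    {σ τ : Stacks} {w : List Bool} {t : Γ'} {x : List Γ'} {T : ℕ}
    (ht : isBit (some t) = false) (hσ : σ.get a = w.map Γ'.bit ++ t :: x) (hu : σ.u = [])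
    (hτu : τ.u = []) (hg : Run (g (some t)) ((σ.set a x).set .u (w.map Γ'.bit).reverse) T
      (τ.set .u (w.map Γ'.bit).reverse)) :
    Run (moveBits a b g) σ (6 * w.length + T + 3) (τ.set b (w.map Γ'.bit ++ τ.get b)) := by
  have h1 := run_moveWhile ha (c := isBit) (w.map Γ'.bit) (t :: x) (by
    intro y hy; obtain ⟨_, _, rfl⟩ := List.mem_map.1 hy; rfl) ht hσ
  have h2 := run_drain hb.symm (τ.set .u (w.map Γ'.bit).reverse)
  rw [Stacks.get_set_self, Stacks.set_set, Stacks.get_set_of_ne _ hb.symm, List.reverse_reverse,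
    Stacks.set_eq_self (k := .u) hτu] at h2
  rw [show σ.get .u = [] from hu, List.append_nil] at h1
  refine (h1.seq ((Run.pop_cons (by
    rw [Stacks.get_set_of_ne _ ha.symm, Stacks.get_set_self]) (?_ : Run _ _ T _)).seq h2)).mono ?_
  · rwa [Stacks.set_comm _ ha.symm, Stacks.set_set]
  · simp; omega

/-- Move a word of bits together with the symbol after it. -/
def moveWord (a b : Reg) : Prog Reg :=
  moveBits a b fun
    | some t => .push b t
    | none => skip

theorem run_moveWord {a b : Reg} (ha : .u ≠ a) (hb : .u ≠ b) (hab : b ≠ a)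
    {σ : Stacks} {w : List Bool} {t : Γ'} {x : List Γ'}
    (ht : isBit (some t) = false) (hσ : σ.get a = w.map Γ'.bit ++ t :: x) (hu : σ.u = []) :
    Run (moveWord a b) σ (6 * w.length + 4)
      ((σ.set a x).set b (w.map Γ'.bit ++ t :: σ.get b)) := by
  have h := run_moveBits (b := b) (T := 1)
    (τ := (σ.set a x).set b (t :: σ.get b)) (g := fun
      | some t => .push b t
      | none => skip) ha hb ht hσ hu ?_ ?_
  · rw [Stacks.get_set_self, Stacks.set_set] at h
    exact h.mono (by omega)
  · change Stacks.get _ .u = _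
    rw [Stacks.get_set_of_ne _ hb, Stacks.get_set_of_ne _ ha]; exact hu
  · have := Run.push ((σ.set a x).set .u (w.map Γ'.bit).reverse) b t
    rwa [Stacks.get_set_of_ne _ hb.symm, Stacks.get_set_of_ne _ hab,
      Stacks.set_comm _ hb.symm] at this

/-- Move a word of bits and drop the symbol after it. -/
def takeWord (a b : Reg) : Prog Reg := moveBits a b fun _ => skip

theorem run_takeWord {a b : Reg} (ha : .u ≠ a) (hb : .u ≠ b) (hab : b ≠ a)
    {σ : Stacks} {w : List Bool} {t : Γ'} {x : List Γ'}
    (ht : isBit (some t) = false) (hσ : σ.get a = w.map Γ'.bit ++ t :: x) (hu : σ.u = []) :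
    Run (takeWord a b) σ (6 * w.length + 4) ((σ.set a x).set b (w.map Γ'.bit ++ σ.get b)) := by
  have h := run_moveBits (b := b) (T := 1) (τ := σ.set a x) (g := fun _ => skip)
    ha hb ht hσ hu ?_ (Run.skip _)
  · rw [Stacks.get_set_of_ne _ hab] at h
    exact h.mono (by omega)
  · change Stacks.get _ .u = _
    rw [Stacks.get_set_of_ne _ ha]; exact hu

/-- Remove a word of bits and the symbol after it. -/
def dropWord (a : Reg) : Prog Reg := .seq (.while a isBit (drop a)) (drop a)

theorem run_dropWord {a : Reg} {σ : Stacks} {w : List Bool} {t : Γ'} {x : List Γ'}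
    (ht : isBit (some t) = false) (hσ : σ.get a = w.map Γ'.bit ++ t :: x) :
    Run (dropWord a) σ (3 * w.length + 3) (σ.set a x) := by
  have h1 : Run (.while a isBit (drop a)) σ (3 * w.length + 1) (σ.set a (t :: x)) := by
    induction w generalizing σ with
    | nil => 
      rw [List.map_nil, List.nil_append] at hσ
      rw [Stacks.set_eq_self hσ]; exact .while_false (by rw [hσ]; exact ht)
    | cons b w ih =>
      have h1 := run_drop a σ
      rw [hσ, List.map_cons, List.cons_append, List.tail_cons] at h1
      have h2 := ih (σ := σ.set a (w.map Γ'.bit ++ t :: x)) (by simp)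
      rw [Stacks.set_set] at h2
      exact (Run.while_true (by rw [hσ]; rfl) h1 h2).mono (by rw [List.length_cons]; omega)
  have h2 := run_drop a (σ.set a (t :: x))
  rw [Stacks.get_set_self, Stacks.set_set, List.tail_cons] at h2
  exact h1.seq h2

/-! ### Binary counters. -/

/-- The value of a word of bits, the least significant bit coming first. -/
def bitsValue : List Bool → ℕ
  | [] => 0
  | x :: l => x.toNat + 2 * bitsValue l

theorem bitsValue_encodeNat (n : ℕ) : bitsValue (encodeNat n) = n := by
  have pos : ∀ p : PosNum, bitsValue (encodePosNum p) = (p : ℕ) := by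
    intro p
    induction p with
    | one => rfl
    | bit0 p ih => simp [encodePosNum, bitsValue, ih, PosNum.cast_bit0]; omega
    | bit1 p ih => simp [encodePosNum, bitsValue, ih, PosNum.cast_bit1]; omega
  have num : ∀ p : Num, bitsValue (encodeNum p) = (p : ℕ) := by
    intro p
    cases p with
    | zero => rfl
    | pos p => exact pos p
  rw [encodeNat, num, Num.to_of_nat]

/-- A decrement depends only on the position of the lowest set bit, if there is one. -/
theorem bits_cases (l : List Bool) :
    (∃ j, l = List.replicate j false) ∨ ∃ j r, l = List.replicate j false ++ true :: r := by
  induction l with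
  | nil => exact .inl ⟨0, rfl⟩
  | cons x l ih =>
    cases x
    · rcases ih with ⟨j, rfl⟩ | ⟨j, r, rfl⟩
      · exact .inl ⟨j + 1, rfl⟩
      · exact .inr ⟨j + 1, r, rfl⟩
    · exact .inr ⟨0, l, rfl⟩

theorem bitsValue_replicate_false (j : ℕ) : bitsValue (List.replicate j false) = 0 := by
  induction j with
  | zero => rfl
  | succ j ih => simp [List.replicate_succ, bitsValue, ih]

theorem bitsValue_borrow (j : ℕ) (r : List Bool) :
    bitsValue (List.replicate j false ++ true :: r) =
      bitsValue (List.replicate j true ++ false :: r) + 1 := by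
  induction j with
  | zero => simp [bitsValue]; omega
  | succ j ih => simp only [List.replicate_succ, List.cons_append, bitsValue, ih]; simp; omega

/-- Decrement a binary number and continue with `ok`; if it was zero, continue with `zero`. -/
def decrement (a : Reg) (ok zero : Prog Reg) : Prog Reg :=
  .seq (.while a (· = some (.bit false)) (.seq (drop a) (.push .u (.bit true)))) <|
  .pop a fun
    | some _ => .seq (.push a (.bit false)) (.seq (drain .u a) ok)
    | none => .seq (clear .u) zero

theorem run_borrow {a : Reg} (ha : .u ≠ a) (j : ℕ) (x : List Γ') (hx : x.head? ≠ some (.bit false))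
    {σ : Stacks} (h : σ.get a = List.replicate j (.bit false) ++ x) :
    Run (.while a (· = some (.bit false)) (.seq (drop a) (.push .u (.bit true)))) σ (4 * j + 1)
      ((σ.set a x).set .u (List.replicate j (.bit true) ++ σ.u)) := by
  induction j generalizing σ with
  | zero => 
    simp only [List.replicate_zero, List.nil_append] at h ⊢
    rw [Stacks.set_eq_self h, show σ.u = σ.get .u from rfl, Stacks.set_get]
    exact .while_false (by rw [h]; simpa using hx)
  | succ j ih =>
    rw [List.replicate_succ, List.cons_append] at h
    have h1 := run_drop a σ
    rw [h, List.tail_cons] at h1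
    have h2 := Run.push (σ.set a (List.replicate j (.bit false) ++ x)) .u (.bit true)
    have h3 := ih (σ := (σ.set a (List.replicate j (.bit false) ++ x)).set .u (.bit true :: σ.u))
      (by rw [Stacks.get_set_of_ne _ ha.symm, Stacks.get_set_self])
    rw [Stacks.set_comm _ ha.symm, Stacks.set_set, Stacks.set_set] at h3
    rw [Stacks.get_set_of_ne _ ha] at h2
    rw [List.replicate_succ', List.append_assoc]
    exact (Run.while_true (by rw [h]; rfl) (h1.seq h2) h3).mono (by omega)

theorem run_decrement_zero {a : Reg} (ha : .u ≠ a) {ok zero : Prog Reg} {l : List Bool}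
    (hl : bitsValue l = 0) {σ τ : Stacks} {T : ℕ} (h : σ.get a = l.map Γ'.bit) (hu : σ.u = [])
    (hz : Run zero (σ.set a []) T τ) :
    Run (decrement a ok zero) σ (7 * l.length + 3 + T) τ := by
  rcases bits_cases l with ⟨j, rfl⟩ | ⟨j, r, rfl⟩
  · have h1 := run_borrow ha j [] (by simp) (σ := σ) (by rw [h]; simp)
    refine (h1.seq (Run.pop_nil ?_ ((run_clear .u _).seq (?_ : Run _ _ T _)))).mono ?_
    · rw [Stacks.get_set_of_ne _ ha.symm, Stacks.get_set_self]
    · rw [Stacks.set_set, Stacks.set_eq_self (k := .u)]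
      · exact hz
      · rw [Stacks.get_set_of_ne _ ha]; exact hu
    · simp [hu]; omega
  · rw [bitsValue_borrow] at hl; omega

/-- Borrowing turns the low zeros into ones and the lowest one into a zero. The result keeps its
leading zeros, so it need not be a canonical numeral; in return its length, and with it the cost of
every later decrement, stays fixed. The word `l'` is chosen before the programs and stacks, so that
loop bodies can refer to it. -/
theorem run_decrement_succ {a : Reg} (ha : .u ≠ a) {l : List Bool}
    (hl : bitsValue l ≠ 0) : ∃ l' : List Bool, l'.length = l.length ∧
      bitsValue l = bitsValue l' + 1 ∧ ∀ {ok zero : Prog Reg} {σ τ : Stacks} {T : ℕ},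
      σ.get a = l.map Γ'.bit → σ.u = [] → Run ok (σ.set a (l'.map Γ'.bit)) T τ →
      Run (decrement a ok zero) σ (7 * l.length + 3 + T) τ := by
  rcases bits_cases l with ⟨j, rfl⟩ | ⟨j, r, rfl⟩
  · exact absurd (bitsValue_replicate_false j) hl
  · refine ⟨List.replicate j true ++ false :: r, by simp, bitsValue_borrow j r, ?_⟩
    intro ok zero σ τ T h hu hz
    have h1 := run_borrow ha j (.bit true :: r.map .bit) (by simp) (σ := σ) (by rw [h]; simp)
    rw [hu, List.append_nil] at h1
    refine (h1.seq (Run.pop_cons (a := .bit true) (l := r.map .bit) ?_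
      ((Run.push _ _ _).seq ((run_drain ha.symm _).seq (?_ : Run _ _ T _))))).mono ?_
    · rw [Stacks.get_set_of_ne _ ha.symm, Stacks.get_set_self]
    · convert hz using 1
      apply Stacks.get_injective
      funext k
      simp only [Stacks.get_set, Function.update_apply]
      by_cases hk : k = .u
      · subst hk
        simp [ha]
        exact hu
      · by_cases hk' : k = a
        · subst hk'; simp [ha]
        · simp [hk, hk']
    · simp [Stacks.get_set, ha]; omega

/-! ### Searching a marked list for a word. -/

/-- Words of bits, each followed by a mark. -/
def encodeMarked (l : List (ℕ × Γ')) : List Γ' :=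
  l.flatMap fun x => (encodeNat x.1).map Γ'.bit ++ [x.2]

/-- Compare the top symbols of the stacks `q` and `w`, and clear the flag `e` if they differ. -/
def compareBit : Prog Reg :=
  .pop .q fun
    | some y => .seq (.push .u y) <| .pop .w fun
      | some z => .seq (.push .v z) (if y = z then .skip else drop .e)
      | none => drop .e
    | none => .skip

/-- Reading along `v` can only test whether `v` is a prefix of `w`; surplus bits of `w` remain for a
later test. Both words are recoverable from `u`, `v` and `w`. The bound on `e` ensures that one drop
erases the flag for good. -/
theorem run_compareBits (v : List Bool) {t : Γ'} (ht : isBit (some t) = false) (x : List Γ')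
    (w : List Bool) (σ : Stacks) (hq : σ.q = v.map Γ'.bit ++ t :: x) (hw : σ.w = w.map Γ'.bit)
    (he : σ.e.length ≤ 1) :
    Run (.while .q isBit compareBit) σ (7 * v.length + 1)
      { σ with
        q := t :: x
        u := (v.map Γ'.bit).reverse ++ σ.u
        w := (w.drop v.length).map Γ'.bit
        v := ((w.take v.length).map Γ'.bit).reverse ++ σ.v
        e := if v <+: w then σ.e else [] } := by
  induction v generalizing σ w with
  | nil =>
    rw [List.map_nil, List.nil_append] at hq
    simp only [List.map_nil, List.reverse_nil, List.nil_append, List.length_nil, List.drop_zero,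
      List.take_zero, List.nil_prefix, if_true, ← hq, ← hw]
    exact .while_false (by change isBit σ.q.head? = _; rw [hq]; exact ht)
  | cons a v ih =>
    have hc : isBit (σ.get .q).head? = true := by
      change isBit σ.q.head? = _; rw [hq]; rfl
    have tail : σ.e.tail = [] := by
      rcases h : σ.e with _ | ⟨z, _ | ⟨z', l⟩⟩
      · rfl
      · rfl
      · rw [h] at he; simp at he
    cases w with
    | nil =>
      have h1 : Run compareBit σ 5
          { σ with q := v.map Γ'.bit ++ t :: x, u := Γ'.bit a :: σ.u, e := [] } := by
        refine .pop_cons (a := .bit a) (l := v.map Γ'.bit ++ t :: x) hq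
          ((Run.push _ _ _).seq (.pop_nil (T := 2) (by exact hw) ?_))
        have := run_drop .e { σ with q := v.map Γ'.bit ++ t :: x, u := Γ'.bit a :: σ.u }
        change Run _ _ _ { σ with q := _, u := _, e := σ.e.tail } at this
        rwa [tail] at this
      have h2 := ih [] { σ with q := v.map Γ'.bit ++ t :: x, u := Γ'.bit a :: σ.u, e := [] }
        rfl hw (by simp)
      refine (Run.while_true hc h1 h2).congr (by rw [List.length_cons]; omega) ?_
      simp
    | cons b w =>
      have h1 : Run compareBit σ 6
          { σ with
            q := v.map Γ'.bit ++ t :: x, u := Γ'.bit a :: σ.u, w := w.map Γ'.bit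
            v := Γ'.bit b :: σ.v, e := if a = b then σ.e else [] } := by
        refine .pop_cons (a := .bit a) (l := v.map Γ'.bit ++ t :: x) hq
          ((Run.push _ _ _).seq (.pop_cons (a := .bit b) (l := w.map Γ'.bit) (T := 3) (by exact hw)
            ((Run.push _ _ _).seq (T' := 2) ?_)))
        by_cases hab : a = b
        · simp only [hab, if_true]
          exact (Run.skip _).mono (by omega)
        · have := run_drop .e { σ with
            q := v.map Γ'.bit ++ t :: x, u := Γ'.bit a :: σ.u, w := w.map Γ'.bit
            v := Γ'.bit b :: σ.v }
          change Run _ _ _ { σ with q := _, u := _, w := _, v := _, e := σ.e.tail } at this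
          rw [tail] at this
          rw [if_neg hab, if_neg (by simpa using hab)]
          exact this
      have h2 := ih w (σ := { σ with
            q := v.map Γ'.bit ++ t :: x, u := Γ'.bit a :: σ.u, w := w.map Γ'.bit
            v := Γ'.bit b :: σ.v, e := if a = b then σ.e else [] }) rfl rfl
            (by dsimp only; split_ifs <;> simp [he])
      refine (Run.while_true hc h1 h2).congr (by rw [List.length_cons]; omega) ?_
      by_cases hab : a = b <;> simp [hab, List.cons_prefix_cons]

/-- Compare the top word of the stack `q` with the word on the stack `w`, and move it to the stack
`r`. If the words agree, replace the mark after the word by `t` and set the flag `f`. -/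
def scanWord (t : Γ') : Prog Reg :=
  .seq (.push .e .comma) <|
  .seq (.while .q isBit compareBit) <|
  .seq (.ite .w Option.isSome (drop .e) .skip) <|
  .seq (drain .v .w) <|
  .seq (.ite .e Option.isSome
    (.seq (drop .e) (.seq (drop .q) (.seq (.push .f .comma) (.push .r t)))) (moveSymbol .q .r)) <|
  drain .u .r

/-- Equality of words decides equality of numbers because `encodeNat` is injective. The word on `w`
is restored, ready for the next comparison. -/
theorem run_scanWord (m : Γ') (a b : ℕ) {t : Γ'} (ht : isBit (some t) = false) (x : List Γ')
    (σ : Stacks) (hq : σ.q = (encodeNat a).map Γ'.bit ++ t :: x)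
    (hw : σ.w = (encodeNat b).map Γ'.bit) (hu : σ.u = []) (hv : σ.v = []) (he : σ.e = []) :
    Run (scanWord m) σ (20 * ((encodeNat a).length + 1))
      { σ with
        q := x
        r := (encodeNat a).map Γ'.bit ++ (if a = b then m else t) :: σ.r
        f := if a = b then .comma :: σ.f else σ.f } := by
  have inj : encodeNat a = encodeNat b ↔ a = b :=
    encodingNatBool.encode_injective.eq_iff
  generalize encodeNat a = v at *
  generalize encodeNat b = w at *
  have h1 := run_compareBits v ht x w { σ with e := [Γ'.comma] } hq hw (by simp)
  simp only [hu, hv, List.append_nil] at h1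
  have h2 : Run (.ite .w Option.isSome (drop .e) .skip)
      { σ with
        q := t :: x
        u := (v.map Γ'.bit).reverse
        w := (w.drop v.length).map Γ'.bit
        v := ((w.take v.length).map Γ'.bit).reverse
        e := if v <+: w then [Γ'.comma] else [] } 3
      { σ with
        q := t :: x
        u := (v.map Γ'.bit).reverse
        w := (w.drop v.length).map Γ'.bit
        v := ((w.take v.length).map Γ'.bit).reverse
        e := if a = b then [Γ'.comma] else [] } := by
    -- If nothing of `w` is left, being a prefix means being equal; if something is left, the words
    -- differ and the flag is dropped.
    rcases hd : w.drop v.length with _ | ⟨z, l⟩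
    · have : v <+: w ↔ a = b := by
        rw [← inj]
        refine ⟨fun ⟨l, hl⟩ => ?_, fun h => h ▸ List.prefix_rfl⟩
        subst hl
        simp at hd
        simp [hd]
      simp only [this, List.map_nil]
      exact (Run.ite_false rfl (Run.skip _)).mono (by omega)
    · have hne : a ≠ b := by
        rintro h
        rw [← inj] at h
        subst h
        simp at hd
      rw [if_neg hne]
      refine Run.ite_true rfl ?_
      have := run_drop .e
        { σ with
          q := t :: x
          u := (v.map Γ'.bit).reverse
          w := (z :: l).map Γ'.bit
          v := ((w.take v.length).map Γ'.bit).reverse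
          e := if v <+: w then [Γ'.comma] else [] }
      refine this.congr le_rfl ?_
      change { σ with q := _, u := _, w := _, v := _, e := List.tail (ite _ _ _) } = _
      split_ifs <;> rfl
  have h3 : Run (drain .v .w) { σ with
        q := t :: x
        u := (v.map Γ'.bit).reverse
        w := (w.drop v.length).map Γ'.bit
        v := ((w.take v.length).map Γ'.bit).reverse
        e := if a = b then [Γ'.comma] else [] } (3 * v.length + 1)
      { σ with
        q := t :: x
        u := (v.map Γ'.bit).reverse
        v := []
        e := if a = b then [Γ'.comma] else [] } := by
    have := run_drain (a := .v) (b := .w) (by decide) { σ with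
        q := t :: x
        u := (v.map Γ'.bit).reverse
        w := (w.drop v.length).map Γ'.bit
        v := ((w.take v.length).map Γ'.bit).reverse
        e := if a = b then [Γ'.comma] else [] }
    simp only [Stacks.get, Stacks.set, List.reverse_reverse, ← List.map_append,
      List.take_append_drop, ← hw] at this
    exact this.mono (by simp)
  have h4 : Run (.ite .e Option.isSome
    (.seq (drop .e) (.seq (drop .q) (.seq (.push .f .comma) (.push .r m)))) (moveSymbol .q .r))
      { σ with
        q := t :: x
        u := (v.map Γ'.bit).reverse
        v := []
        e := if a = b then [Γ'.comma] else [] } 7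
      { σ with
        q := x
        u := (v.map Γ'.bit).reverse
        v := []
        r := (if a = b then m else t) :: σ.r
        f := if a = b then .comma :: σ.f else σ.f
        e := [] } := by
    by_cases hab : a = b
    · simp only [hab, if_true]
      exact .ite_true rfl ((run_drop _ _).seq ((run_drop _ _).seq ((Run.push _ _ _).seq
        (Run.push _ _ _))))
    · simp only [hab, if_false]
      exact (Run.ite_false rfl (run_moveSymbol (by decide) rfl)).mono (by omega)
  have h5 := run_drain (a := .u) (b := .r) (by decide) { σ with
        q := x
        u := (v.map Γ'.bit).reverse
        v := []
        r := (if a = b then m else t) :: σ.r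
        f := if a = b then .comma :: σ.f else σ.f
        e := [] }
  simp only [Stacks.get, Stacks.set, List.reverse_reverse] at h5
  have h0 : Run (.push .e .comma) σ 1 { σ with u := [], v := [], e := [Γ'.comma] } := by
    refine (Run.push σ .e .comma).congr le_rfl ?_
    simp only [Stacks.get, Stacks.set, hu, hv, he]
  refine (h0.seq (h1.seq (h2.seq (h3.seq (h4.seq h5))))).congr (by simp; omega) ?_
  simp only [hu, hv, he]

/-- Look for the word on the stack `w` in the list of words on the stack `q`. If it occurs, replace
the mark after it by `t` and set the flag `f`. -/
def scan (t : Γ') : Prog Reg :=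
  .seq (.while .q Option.isSome (scanWord t)) (.while .r Option.isSome (moveWord .r .q))

def markWord (t : Γ') (b : ℕ) (l : List (ℕ × Γ')) : List (ℕ × Γ') :=
  l.map fun x => (x.1, if x.1 = b then t else x.2)

def Marked (l : List (ℕ × Γ')) : Prop := ∀ x ∈ l, isBit (some x.2) = false

theorem Marked.markWord {l : List (ℕ × Γ')} (hl : Marked l) {t : Γ'} (ht : isBit (some t) = false)
    (b : ℕ) : Marked (markWord t b l) := by
  intro x hx
  obtain ⟨y, hy, rfl⟩ := List.mem_map.1 hx
  dsimp only
  split_ifs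
  exacts [ht, hl y hy]

theorem length_encodeMarked_markWord (t : Γ') (b : ℕ) (l : List (ℕ × Γ')) :
    (encodeMarked (markWord t b l)).length = (encodeMarked l).length := by
  simp [encodeMarked, markWord, List.length_flatMap, Function.comp_def]

theorem encodeMarked_cons (x : ℕ × Γ') (l : List (ℕ × Γ')) :
    encodeMarked (x :: l) = (encodeNat x.1).map Γ'.bit ++ x.2 :: encodeMarked l := by
  simp [encodeMarked]

theorem encodeMarked_append (l l' : List (ℕ × Γ')) :
    encodeMarked (l ++ l') = encodeMarked l ++ encodeMarked l' := by
  simp [encodeMarked]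

theorem isSome_head?_encodeMarked_cons (x : ℕ × Γ') (l : List (ℕ × Γ')) :
    (encodeMarked (x :: l)).head?.isSome = true := by
  rw [encodeMarked_cons]
  cases (encodeNat x.1) <;> rfl

/-- Move all words from one stack to another one, in reversed order. -/
theorem run_moveWords {a b : Reg} (ha : .u ≠ a) (hb : .u ≠ b) (hab : b ≠ a)
    (l : List (ℕ × Γ')) (hl : Marked l) (σ : Stacks) (h : σ.get a = encodeMarked l)
    (hu : σ.u = []) :
    Run (.while a Option.isSome (moveWord a b)) σ (7 * (encodeMarked l).length + 1)
      ((σ.set a []).set b (encodeMarked l.reverse ++ σ.get b)) := by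
  induction l generalizing σ with
  | nil =>
    rw [show ([] : List Γ') = encodeMarked [] from rfl, Stacks.set_eq_self h, List.reverse_nil]
    change Run _ _ _ (σ.set b (σ.get b))
    rw [Stacks.set_get]
    exact .while_false (by rw [h]; rfl)
  | cons x l ih =>
    have h1 := run_moveWord ha hb hab (hl x List.mem_cons_self)
      (h.trans (encodeMarked_cons x l)) hu
    have h2 := ih (fun y hy => hl y (List.mem_cons_of_mem _ hy))
      ((σ.set a (encodeMarked l)).set b ((encodeNat x.1).map Γ'.bit ++ x.2 :: σ.get b)) (by
      rw [Stacks.get_set_of_ne _ hab.symm, Stacks.get_set_self]) (by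
      change Stacks.get _ .u = _
      rw [Stacks.get_set_of_ne _ hb, Stacks.get_set_of_ne _ ha]; exact hu)
    refine (Run.while_true (by rw [h]; exact isSome_head?_encodeMarked_cons x l) h1 h2).congr ?_ ?_
    rotate_left
    · rw [Stacks.get_set_self, Stacks.set_comm _ hab.symm, Stacks.set_set, Stacks.set_set,
        List.reverse_cons, encodeMarked_append, encodeMarked_cons x []]
      simp [encodeMarked]
    · rw [encodeMarked_cons]; simp; omega

/-- The first pass reverses the order of the words and the way back restores it. The stack `f`
receives one symbol per occurrence, so it is nonempty exactly if the word was found. -/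
theorem run_scan {t : Γ'} (ht : isBit (some t) = false) (b : ℕ) (l : List (ℕ × Γ'))
    (hl : Marked l) (σ : Stacks) (hq : σ.q = encodeMarked l)
    (hw : σ.w = (encodeNat b).map Γ'.bit) (hr : σ.r = []) (hu : σ.u = []) (hv : σ.v = [])
    (he : σ.e = []) :
    Run (scan t) σ (28 * (encodeMarked l).length + 2)
      { σ with
        q := encodeMarked (markWord t b l)
        f := (l.filter (·.1 = b)).map (fun _ => Γ'.comma) ++ σ.f } := by
  have h1 : ∀ (l : List (ℕ × Γ')) (hl : Marked l) (σ : Stacks) (hq : σ.q = encodeMarked l)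
      (hw : σ.w = (encodeNat b).map Γ'.bit) (hu : σ.u = []) (hv : σ.v = []) (he : σ.e = []),
      Run (.while .q Option.isSome (scanWord t)) σ (21 * (encodeMarked l).length + 1)
      { σ with
        q := []
        r := encodeMarked (markWord t b l).reverse ++ σ.r
        f := (l.filter (·.1 = b)).map (fun _ => Γ'.comma) ++ σ.f } := by
    intro l hl σ hq hw hu hv he
    induction l generalizing σ with
    | nil =>
      change σ.q = [] at hq
      refine (Run.while_false (by change σ.q.head?.isSome = _; rw [hq]; rfl)).congr
        (Nat.le_add_left _ _) ?_
      rw [← hq]; rfl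
    | cons x l ih =>
      have h1 := run_scanWord t x.1 b (hl x List.mem_cons_self) _ σ
        (hq.trans (encodeMarked_cons x l)) hw hu hv he
      have h2 := ih (fun y hy => hl y (List.mem_cons_of_mem _ hy)) { σ with
        q := encodeMarked l
        r := (encodeNat x.1).map Γ'.bit ++ (if x.1 = b then t else x.2) :: σ.r
        f := if x.1 = b then .comma :: σ.f else σ.f } rfl hw hu hv he
      refine (Run.while_true (by
        change (σ.q).head?.isSome = _
        rw [hq]; exact isSome_head?_encodeMarked_cons x l) h1 h2).congr ?_ ?_
      rotate_left
      · congr 1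
        · simp [markWord, encodeMarked_append, encodeMarked_cons]
          simp [encodeMarked]
        · by_cases hx : x.1 = b
          · simp only [hx, decide_true, List.filter_cons_of_pos, if_true, List.map_cons]
            -- All flag symbols are equal, so it does not matter at which end the new one is added.
            rw [List.append_cons, ← List.map_cons (f := fun _ => Γ'.comma) (a := x)]
            congr 1
            simp [List.map_const', ← List.replicate_succ', ← List.replicate_succ]
          · simp [hx]
      · rw [encodeMarked_cons]; simp; omega
  have h2 := run_moveWords (a := .r) (b := .q) (by decide) (by decide) (by decide)
    (markWord t b l).reverse (fun x hx => hl.markWord ht b x (by simpa using hx))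
    { σ with
        q := []
        r := encodeMarked (markWord t b l).reverse ++ σ.r
        f := (l.filter (·.1 = b)).map (fun _ => Γ'.comma) ++ σ.f } (by
      change _ ++ σ.r = _; rw [hr, List.append_nil]) hu
  refine ((h1 l hl σ hq hw hu hv he).seq h2).congr ?_ ?_
  rotate_left
  · change { σ with q := _, r := [], f := _ } = _
    congr 1
    · simp [Stacks.get]
    · exact hr.symm
  · have : (encodeMarked (markWord t b l).reverse).length = (encodeMarked l).length := by
      rw [← length_encodeMarked_markWord t b l]
      simp [encodeMarked, List.length_flatMap]
    rw [this]; omega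

/-! ### Reading the input and cutting off the front of the tie-break order. -/

open ObviousManipulation

theorem encodeNumber_eq (a : ℕ) : encodeNumber a = (encodeNat a).map Γ'.bit ++ [Γ'.comma] := rfl

/-- A list of numbers in binary, each followed by a comma. -/
def encodeWords (l : List ℕ) : List Γ' := l.flatMap encodeNumber

theorem encodeWords_cons (a : ℕ) (l : List ℕ) :
    encodeWords (a :: l) = (encodeNat a).map Γ'.bit ++ Γ'.comma :: encodeWords l := by
  simp [encodeWords, encodeNumber_eq]

theorem encodeWords_append (l l' : List ℕ) :
    encodeWords (l ++ l') = encodeWords l ++ encodeWords l' := by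
  simp [encodeWords]

theorem encodeMarked_comma (l : List ℕ) :
    encodeMarked (l.map fun a => (a, Γ'.comma)) = encodeWords l := by
  simp only [encodeMarked, encodeWords, List.flatMap_map]; rfl

theorem head?_encodeWords_cons_ne (a : ℕ) (l : List ℕ) (x : List Γ') :
    (encodeWords (a :: l) ++ x).head? ≠ some .ket := by
  rw [encodeWords_cons]
  cases encodeNat a <;> simp

theorem isSome_head?_encodeWords_cons (a : ℕ) (l : List ℕ) :
    (encodeWords (a :: l)).head?.isSome = true := by
  rw [encodeWords_cons]
  cases encodeNat a <;> rfl

def atKet (x : Option Γ') : Bool := x = some .ket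

/-- Read the list of the preference, counting its length in unary on `c` and `d`. -/
def readPref : Prog Reg :=
  .while .i (fun x => !atKet x)
    (.seq (moveWord .i .p) (.seq (.push .c .comma) (.push .d .comma)))

theorem run_readPref (l : List ℕ) (x : List Γ') (σ : Stacks) (hi : σ.i = encodeWords l ++ .ket :: x)
    (hu : σ.u = []) :
    Run readPref σ (7 * (encodeWords l).length + 1)
      { σ with
        i := .ket :: x
        p := encodeWords l.reverse ++ σ.p
        c := List.replicate l.length .comma ++ σ.c
        d := List.replicate l.length .comma ++ σ.d } := by
  induction l generalizing σ with
  | nil => 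
    refine (Run.while_false (by change (!atKet σ.i.head?) = _; rw [hi]; rfl)).congr
      (Nat.le_add_left _ _) ?_
    simp only [encodeWords, List.flatMap_nil, List.nil_append] at hi
    rw [← hi]; rfl
  | cons a l ih =>
    have hc : (!atKet (σ.get .i).head?) = true := by
      change (!atKet σ.i.head?) = true
      rw [hi, atKet, decide_eq_false (head?_encodeWords_cons_ne a l _)]; rfl
    rw [encodeWords_cons, List.append_assoc] at hi
    have h1 := run_moveWord (a := .i) (b := .p) (by decide) (by decide) (by decide) rfl hi hu
    have h2 := ih { σ with
      i := encodeWords l ++ .ket :: x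
      p := (encodeNat a).map Γ'.bit ++ .comma :: σ.p
      c := .comma :: σ.c
      d := .comma :: σ.d } rfl hu
    refine (Run.while_true hc (h1.seq ((Run.push _ _ _).seq (Run.push _ _ _))) h2).congr ?_ ?_
    · simp [encodeWords_cons]; omega
    · simp [encodeWords_append, encodeWords_cons, List.replicate_succ']
      simp [encodeWords]

/-- Subtract the number on `b` from the unary numbers on `c` and `d`. -/
def subtractApproved : Prog Reg :=
  .while .e Option.isSome (decrement .b (.seq (drop .c) (drop .d)) (drop .e))

/-- The flag on `e` keeps the loop alive until a decrement meets zero. The cost is proportional to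
the value of the counter, which is harmless because it is used with k < m. -/
theorem run_subtractApproved (l : List Bool) (j : ℕ) (σ : Stacks) (hb : σ.b = l.map Γ'.bit)
    (hu : σ.u = []) (he : σ.e = [.comma]) (hc : σ.c = List.replicate j .comma)
    (hd : σ.d = List.replicate j .comma) :
    Run subtractApproved σ ((bitsValue l + 1) * (7 * l.length + 8) + 1)
      { σ with
        b := []
        e := []
        c := List.replicate (j - bitsValue l) .comma
        d := List.replicate (j - bitsValue l) .comma } := by
  have hce : (σ.get .e).head?.isSome = true := by change σ.e.head?.isSome = _; rw [he]; rfl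
  induction h : bitsValue l generalizing l j σ with
  | zero =>
    have h1 : Run (drop .e) (σ.set .b []) 2 { σ with b := [], e := [] } := by
      refine (run_drop .e _).congr le_rfl ?_
      change { σ with b := [], e := σ.e.tail } = _
      rw [he]; rfl
    refine (Run.while_true hce (run_decrement_zero (a := .b) (by decide) h hb hu h1)
      (Run.while_false rfl)).congr (by omega) ?_
    rw [Nat.sub_zero, ← hc]
    simp only [hc, ← hd]
  | succ n ih =>
    obtain ⟨l', hl, hv, hrun⟩ := run_decrement_succ (a := .b) (by decide) (l := l) (by omega)
    have h1 : Run (.seq (drop .c) (drop .d)) (σ.set .b (l'.map Γ'.bit)) 4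
        { σ with
          b := l'.map Γ'.bit
          c := List.replicate (j - 1) .comma
          d := List.replicate (j - 1) .comma } := by
      refine ((run_drop .c _).seq (run_drop .d _)).congr le_rfl ?_
      change { σ with b := _, c := σ.c.tail, d := σ.d.tail } = _
      rw [hc, hd, List.tail_replicate]
      rfl
    have h2 := ih l' (j - 1) { σ with
          b := l'.map Γ'.bit
          c := List.replicate (j - 1) .comma
          d := List.replicate (j - 1) .comma } rfl hu he rfl rfl hce (by omega)
    refine (Run.while_true hce (hrun hb hu h1) h2).congr ?_ ?_
    · rw [hl]; ring_nf; omega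
    · rw [show j - 1 - n = j - (n + 1) by omega]

/-- Move as many words of the tie-break order to `q` as there are symbols on `c`, which are moved
to `v`. -/
def takeBlock : Prog Reg :=
  .while .c Option.isSome (.seq (moveSymbol .c .v) (.ite .i atKet .skip (moveWord .i .q)))

theorem atKet_encodeWords (l : List ℕ) (x : List Γ') :
    atKet (encodeWords l ++ .ket :: x).head? = l.isEmpty := by
  cases l with
  | nil => rfl
  | cons a l => exact decide_eq_false (head?_encodeWords_cons_ne a l _)

/-- When the list runs out, the remaining symbols of `c` are still moved to `v`, so that the unary
number can be restored in full for the next block. -/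
theorem run_takeBlock (j : ℕ) (l : List ℕ) (x : List Γ') (σ : Stacks)
    (hi : σ.i = encodeWords l ++ .ket :: x) (hc : σ.c = List.replicate j .comma) (hu : σ.u = []) :
    Run takeBlock σ (5 * j + 7 * (encodeWords l).length + 1)
      { σ with
        i := encodeWords (l.drop j) ++ .ket :: x
        q := encodeWords (l.take j).reverse ++ σ.q
        c := []
        v := List.replicate j .comma ++ σ.v } := by
  induction j generalizing l σ with
  | zero =>
    refine (Run.while_false (by change (σ.c.head?).isSome = _; rw [hc]; rfl)).congr
      (Nat.le_add_left _ _) ?_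
    simp only [List.drop_zero, ← hi, List.replicate_zero, List.take_zero, List.reverse_nil,
      List.nil_append]
    rw [List.replicate_zero] at hc
    rw [← hc]
    rfl
  | succ j ih =>
    have hcc : ((σ.get .c).head?).isSome = true := by
      change (σ.c.head?).isSome = _; rw [hc]; rfl
    have h1 : Run (moveSymbol .c .v) σ 2
        { σ with c := List.replicate j .comma, v := .comma :: σ.v } :=
      run_moveSymbol (a := .c) (b := .v) (by decide) hc
    cases l with
    | nil =>
      have h2 := ih [] { σ with c := List.replicate j .comma, v := .comma :: σ.v } hi rfl hu
      refine (Run.while_true hcc (h1.seq (Run.ite_true ?_ (Run.skip _))) h2).congr ?_ ?_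
      · change atKet σ.i.head? = true
        rw [hi]; rfl
      · omega
      · simp [encodeWords, List.replicate_succ']
    | cons a l =>
      have hk : atKet σ.i.head? = false := by rw [hi]; exact atKet_encodeWords (a :: l) x
      rw [encodeWords_cons, List.append_assoc] at hi
      have h2 := run_moveWord (a := .i) (b := .q) (by decide) (by decide) (by decide) rfl
        (σ := { σ with c := List.replicate j .comma, v := .comma :: σ.v }) hi hu
      have h3 := ih l { σ with
        i := encodeWords l ++ .ket :: x
        q := (encodeNat a).map Γ'.bit ++ .comma :: σ.q
        c := List.replicate j .comma
        v := .comma :: σ.v } rfl rfl hu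
      refine (Run.while_true hcc (h1.seq (Run.ite_false hk h2)) h3).congr ?_ ?_
      · simp [encodeWords_cons]; omega
      · simp [encodeWords_append, encodeWords_cons, List.replicate_succ']
        simp [encodeWords]

/-- Move to `q` as many words of the tie-break order as the product of the binary number on `n`
and the unary number on `c`, or all of them if there are not that many. -/
def takeFront : Prog Reg :=
  .while .e Option.isSome (decrement .n
    (.seq takeBlock (.seq (drain .v .c) (.ite .i atKet (drop .e) .skip))) (drop .e))

/-- Each round consumes j > 0 words or ends the loop, so the number of rounds is bounded by the
length of the list and not by the value of the binary counter, which may be exponential. The product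
is never computed. When the list ends early, an unspecified remainder `y` is left on `n`. -/
theorem run_takeFront (j : ℕ) (hj : 0 < j) (x : List Γ') (N : ℕ) (l : List ℕ) (w : List Bool)
    (hN : (encodeWords l).length ≤ N) (σ : Stacks)
    (hn : σ.n = w.map Γ'.bit) (hi : σ.i = encodeWords l ++ .ket :: x)
    (hc : σ.c = List.replicate j .comma) (hu : σ.u = []) (hv : σ.v = []) (he : σ.e = [.comma]) :
    ∃ y : List Γ', y.length ≤ w.length ∧
      Run takeFront σ ((l.length + 1) * (7 * w.length + 8 * j + 7 * N + 9) + 1)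
      { σ with
        n := y
        i := encodeWords (l.drop (bitsValue w * j)) ++ .ket :: x
        q := encodeWords (l.take (bitsValue w * j)).reverse ++ σ.q
        e := [] } := by
  induction hm : l.length using Nat.strong_induction_on generalizing l w σ with
  | _ m ih =>
  subst hm
  have hce : (σ.get .e).head?.isSome = true := by change σ.e.head?.isSome = _; rw [he]; rfl
  by_cases hz : bitsValue w = 0
  · have h1 : Run (drop .e) (σ.set .n []) 2 { σ with n := [], e := [] } := by
      refine (run_drop .e _).congr le_rfl ?_
      change { σ with n := [], e := σ.e.tail } = _
      rw [he]; rfl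
    refine ⟨[], by simp, ?_⟩
    refine (Run.while_true hce (run_decrement_zero (a := .n) (by decide) hz hn hu h1)
      (Run.while_false rfl)).congr ?_ ?_
    · rw [add_mul]; nlinarith [Nat.zero_le (l.length * (7 * w.length + 8 * j + 7 * N + 9))]
    · simp [hz, ← hi]
      simp [encodeWords]
  · obtain ⟨w', hw, hval, hrun⟩ := run_decrement_succ (a := .n) (by decide) (l := w) hz
    have h1 := run_takeBlock j l x (σ.set .n (w'.map Γ'.bit)) hi hc hu
    have h2 : Run (drain .v .c) { σ with
        n := w'.map Γ'.bit
        i := encodeWords (l.drop j) ++ .ket :: x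
        q := encodeWords (l.take j).reverse ++ σ.q
        c := []
        v := List.replicate j .comma ++ σ.v } (3 * j + 1) { σ with
        n := w'.map Γ'.bit
        i := encodeWords (l.drop j) ++ .ket :: x
        q := encodeWords (l.take j).reverse ++ σ.q } := by
      refine (run_drain (a := .v) (b := .c) (by decide) { σ with
        n := w'.map Γ'.bit
        i := encodeWords (l.drop j) ++ .ket :: x
        q := encodeWords (l.take j).reverse ++ σ.q
        c := []
        v := List.replicate j .comma ++ σ.v }).congr ?_ ?_
      · simp [Stacks.get, hv]
      · simp [Stacks.get, Stacks.set, hv, hc]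
    by_cases hd : l.drop j = []
    · have h3 : Run (.ite .i atKet (drop .e) .skip) { σ with
        n := w'.map Γ'.bit
        i := encodeWords (l.drop j) ++ .ket :: x
        q := encodeWords (l.take j).reverse ++ σ.q } 3 { σ with
        n := w'.map Γ'.bit
        i := encodeWords (l.drop j) ++ .ket :: x
        q := encodeWords (l.take j).reverse ++ σ.q
        e := [] } := by
        refine (Run.ite_true ?_ (run_drop .e _)).congr le_rfl ?_
        · exact (atKet_encodeWords _ _).trans (by simp [hd])
        · change { σ with n := _, i := _, q := _, e := σ.e.tail } = _
          rw [he]; rfl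
      refine ⟨w'.map Γ'.bit, by simp [hw], ?_⟩
      refine (Run.while_true hce (hrun hn hu (h1.seq (h2.seq h3))) (Run.while_false rfl)).congr ?_ ?_
      · rw [add_mul]; nlinarith [Nat.zero_le (l.length * (7 * w.length + 8 * j + 7 * N + 9))]
      · have hlen : l.length ≤ j := by simpa using hd
        -- The loop stopped early because the list is exhausted; the full product would not have
        -- taken more.
        have hle : l.length ≤ bitsValue w * j := hlen.trans (Nat.le_mul_of_pos_left _ (by omega))
        simp [List.drop_eq_nil_of_le hle, hd, List.take_of_length_le hle,
          List.take_of_length_le hlen]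
    · have hlen : j < l.length := by simpa using hd
      have h3 : Run (.ite .i atKet (drop .e) .skip) { σ with
        n := w'.map Γ'.bit
        i := encodeWords (l.drop j) ++ .ket :: x
        q := encodeWords (l.take j).reverse ++ σ.q } 3 _ :=
        (Run.ite_false ((atKet_encodeWords _ _).trans (by simpa using hd)) (Run.skip _)).mono
          (by omega)
      have hN' : (encodeWords (l.drop j)).length ≤ N := by
        refine le_trans ?_ hN
        conv_rhs => rw [← List.take_append_drop j l, encodeWords_append]
        simp
      obtain ⟨y, hy, h4⟩ := ih (l.drop j).length (by simp; omega) (l.drop j) w' hN' { σ with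
        n := w'.map Γ'.bit
        i := encodeWords (l.drop j) ++ .ket :: x
        q := encodeWords (l.take j).reverse ++ σ.q } rfl rfl hc hu hv he rfl
      refine ⟨y, hw ▸ hy, ?_⟩
      refine (Run.while_true hce (hrun hn hu (h1.seq (h2.seq h3))) h4).congr ?_ ?_
      · have : (l.drop j).length + 1 ≤ l.length := by simp; omega
        have := Nat.mul_le_mul_right (7 * w.length + 8 * j + 7 * N + 9) this
        rw [hw, add_mul l.length]
        omega
      · rw [hval, add_mul, one_mul, add_comm, List.drop_drop, List.take_add]
        simp [encodeWords_append]

/-! ### Splitting the outcomes into approved and omitted ones. -/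

theorem markWord_eq_self {t : Γ'} {b : ℕ} {l : List (ℕ × Γ')} (hb : b ∉ l.map Prod.fst) :
    markWord t b l = l := by
  refine List.map_id'' (fun _ => rfl) l |> fun h => Eq.trans (List.map_congr_left ?_) h
  intro x hx
  have : x.1 ≠ b := fun h => hb (h ▸ List.mem_map_of_mem hx)
  simp [this]

/-- Split the outcomes of the list into approved ones and omitted ones. The first `c` outcomes that
occur in `Q` are omitted and get a mark in `Q`, which tells whether they are among the first `d`
outcomes of the list. -/
def distribute : List ℕ → ℕ → ℕ → List (ℕ × Γ') → List ℕ → List ℕ →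
    List (ℕ × Γ') × List ℕ × List ℕ
  | [], _, _, Q, S, X => (Q, S, X)
  | a :: l, c, d, Q, S, X =>
    if 0 < c ∧ a ∈ Q.map Prod.fst then
      -- With `d` starting at m-k and the list running from worst to best, `blank` marks an outcome
      -- that the truthful report omits too, and `bra` one that it approves. Unmarked outcomes of
      -- the front keep their comma.
      distribute l (c - 1) (d - 1) (markWord (if 0 < d then .blank else .bra) a Q) S (a :: X)
    else distribute l c (d - 1) Q (a :: S) X

/-- Put the word on `w`, followed by a comma, on another stack. -/
def putWord (a : Reg) : Prog Reg := .seq (.push a .comma) (.seq (drain .w .u) (drain .u a))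

def distributeStep : Prog Reg :=
  .seq (takeWord .p .w) <|
  .seq (.ite .c Option.isSome (.ite .d Option.isSome (scan .blank) (scan .bra)) .skip) <|
  .seq (.ite .f Option.isSome (.seq (clear .f) (.seq (drop .c) (putWord .o))) (putWord .s)) <|
  drop .d

def distributeAll : Prog Reg := .while .p Option.isSome distributeStep

theorem head?_replicate_isSome (c : ℕ) :
    (List.replicate c Γ'.comma).head?.isSome = decide (0 < c) := by
  cases c <;> simp

theorem run_distributeScan (a c d : ℕ) (Q : List (ℕ × Γ')) (hQ : Marked Q)
    (σ : Stacks) (hq : σ.q = encodeMarked Q) (hw : σ.w = (encodeNat a).map Γ'.bit)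
    (hr : σ.r = []) (hu : σ.u = []) (hv : σ.v = []) (he : σ.e = []) (hf : σ.f = [])
    (hc : σ.c = List.replicate c .comma) (hd : σ.d = List.replicate d .comma) :
    Run (.ite .c Option.isSome (.ite .d Option.isSome (scan .blank) (scan .bra)) .skip) σ
      (28 * (encodeMarked Q).length + 4)
      { σ with
        q := encodeMarked (if 0 < c then markWord (if 0 < d then .blank else .bra) a Q else Q)
        f := if 0 < c then (Q.filter (·.1 = a)).map (fun _ => Γ'.comma) else [] } := by
  by_cases h0 : 0 < c
  · have hc' : (σ.get .c).head?.isSome = true := by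
      change σ.c.head?.isSome = true; rw [hc, head?_replicate_isSome]; simpa using h0
    simp only [h0, if_true]
    by_cases h1 : 0 < d
    · have hd' : (σ.get .d).head?.isSome = true := by
        change σ.d.head?.isSome = true; rw [hd, head?_replicate_isSome]; simpa using h1
      have h := run_scan (t := .blank) rfl a Q hQ σ hq hw hr hu hv he
      rw [hf, List.append_nil] at h
      simp only [h1, if_true]
      exact .ite_true hc' (.ite_true hd' h)
    · have hd' : (σ.get .d).head?.isSome = false := by
        change σ.d.head?.isSome = false; rw [hd, head?_replicate_isSome]; simpa using h1
      have h := run_scan (t := .bra) rfl a Q hQ σ hq hw hr hu hv he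
      rw [hf, List.append_nil] at h
      simp only [h1, if_false]
      exact .ite_true hc' (.ite_false hd' h)
  · have hc' : (σ.get .c).head?.isSome = false := by
      change σ.c.head?.isSome = false; rw [hc, head?_replicate_isSome]; simpa using h0
    simp only [h0, if_false, ← hq, ← hf]
    exact (Run.ite_false hc' (Run.skip σ)).mono (by omega)

theorem run_putWord {k : Reg} (hkw : k ≠ .w) (hku : k ≠ .u) (a : ℕ) (σ : Stacks)
    (hw : σ.w = (encodeNat a).map Γ'.bit) (hu : σ.u = []) :
    Run (putWord k) σ (6 * (encodeNat a).length + 3)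
      ((σ.set .w []).set k (encodeNumber a ++ σ.get k)) := by
  have h1 := Run.push σ k .comma
  have h2 := run_drain (a := .w) (b := .u) (by decide) (σ.set k (.comma :: σ.get k))
  rw [Stacks.get_set_of_ne _ hkw.symm, Stacks.get_set_of_ne _ hku.symm] at h2
  have h3 := run_drain (a := .u) (b := k) hku (((σ.set k (.comma :: σ.get k)).set .w []).set .u
    ((σ.get .w).reverse ++ σ.get .u))
  refine (h1.seq (h2.seq h3)).congr ?_ ?_
  · simp only [Stacks.get_set_self]
    simp [Stacks.get, hw, hu]
    omega
  · apply Stacks.get_injective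
    have hw' : σ.get .w = (encodeNat a).map Γ'.bit := hw
    have hu' : σ.get .u = [] := hu
    funext j
    simp only [Stacks.get_set, Function.update_apply]
    by_cases hj : j = k
    · simp [hj, hkw, hku, hw', hu', encodeNumber_eq]
    · by_cases hj' : j = .u
      · subst hj'; simp [hj, hu']
      · simp [hj, hj']

theorem run_distributeStep (a c d : ℕ) (Q : List (ℕ × Γ')) (hQ : Marked Q) (x : List Γ')
    (σ : Stacks) (hp : σ.p = (encodeNat a).map Γ'.bit ++ .comma :: x) (hq : σ.q = encodeMarked Q)
    (hw : σ.w = []) (hr : σ.r = []) (hu : σ.u = []) (hv : σ.v = []) (he : σ.e = []) (hf : σ.f = [])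
    (hc : σ.c = List.replicate c .comma) (hd : σ.d = List.replicate d .comma) :
    Run distributeStep σ (39 * ((encodeMarked Q).length + (encodeNat a).length + 1))
      (if 0 < c ∧ a ∈ Q.map Prod.fst then
        { σ with
          p := x
          q := encodeMarked (markWord (if 0 < d then .blank else .bra) a Q)
          c := List.replicate (c - 1) .comma
          d := List.replicate (d - 1) .comma
          o := encodeNumber a ++ σ.o }
      else
        { σ with
          p := x
          d := List.replicate (d - 1) .comma
          s := encodeNumber a ++ σ.s }) := by
  have h1 : Run (takeWord .p .w) σ (6 * (encodeNat a).length + 4)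
      { σ with p := x, w := (encodeNat a).map Γ'.bit } := by
    refine (run_takeWord (a := .p) (b := .w) (by decide) (by decide) (by decide) rfl hp hu).congr
      le_rfl ?_
    change { σ with p := x, w := _ ++ σ.w } = _
    rw [hw, List.append_nil]
  have h2 := run_distributeScan a c d Q hQ { σ with p := x, w := (encodeNat a).map Γ'.bit }
    hq rfl hr hu hv he hf hc hd
  by_cases h : 0 < c ∧ a ∈ Q.map Prod.fst
  · have hne : (Q.filter (·.1 = a)).map (fun _ => Γ'.comma) ≠ [] := by
      obtain ⟨y, hy, hya⟩ := List.mem_map.1 h.2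
      simp only [ne_eq, List.map_eq_nil_iff]
      exact List.ne_nil_of_mem (List.mem_filter.2 ⟨hy, by simpa using hya⟩)
    have hlen : ((Q.filter (·.1 = a)).map (fun _ => Γ'.comma)).length ≤ (encodeMarked Q).length := by
      rw [List.length_map]
      refine (List.length_filter_le _ _).trans ?_
      clear * -
      induction Q with
      | nil => simp
      | cons y Q ih => rw [encodeMarked_cons]; simp; omega
    simp only [h.1, if_true] at h2
    generalize (Q.filter (·.1 = a)).map (fun _ => Γ'.comma) = F at *
    have h3 := run_clear .f { σ with
      p := x
      w := (encodeNat a).map Γ'.bit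
      q := encodeMarked (markWord (if 0 < d then .blank else .bra) a Q)
      f := F }
    have h4 := run_drop .c { σ with
      p := x
      w := (encodeNat a).map Γ'.bit
      q := encodeMarked (markWord (if 0 < d then .blank else .bra) a Q)
      f := [] }
    have h5 := run_putWord (k := .o) (by decide) (by decide) a { σ with
      p := x
      w := (encodeNat a).map Γ'.bit
      q := encodeMarked (markWord (if 0 < d then .blank else .bra) a Q)
      f := []
      c := σ.c.tail } rfl hu
    have h6 := run_drop .d { σ with
      p := x
      w := []
      q := encodeMarked (markWord (if 0 < d then .blank else .bra) a Q)
      f := []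
      c := σ.c.tail
      o := encodeNumber a ++ σ.o }
    have hF : Option.isSome F.head? = true := by
      cases F with
      | nil => exact absurd rfl hne
      | cons => rfl
    refine (h1.seq (h2.seq ((Run.ite_true hF (h3.seq (h4.seq h5))).seq h6))).congr ?_ ?_
    · change _ + (_ + (3 * F.length + 1 + _ + _ + _)) ≤ _
      omega
    · rw [if_pos h]
      change { σ with p := _, q := _, w := _, f := _, c := _, o := _, d := σ.d.tail } = _
      rw [hc, hd, List.tail_replicate, List.tail_replicate]
      simp only [hw, hf]
  -- Either no omission is left and the scan is skipped, or the scan finds nothing; both leave the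
  -- marks and the flag untouched.
  · have hq' : (if 0 < c then markWord (if 0 < d then .blank else .bra) a Q else Q) = Q := by
      split_ifs with h0 h1
      · exact markWord_eq_self fun h2 => h ⟨h0, h2⟩
      · exact markWord_eq_self fun h2 => h ⟨h0, h2⟩
      · rfl
    have hf' : (if 0 < c then (Q.filter (·.1 = a)).map (fun _ => Γ'.comma) else []) = [] := by
      split_ifs with h0
      · rw [List.map_eq_nil_iff, List.filter_eq_nil_iff]
        intro y hy hya
        exact h ⟨h0, List.mem_map.2 ⟨y, hy, by simpa using hya⟩⟩
      · rfl
    rw [hq', hf'] at h2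
    have h5 := run_putWord (k := .s) (by decide) (by decide) a { σ with
      p := x
      w := (encodeNat a).map Γ'.bit
      q := encodeMarked Q
      f := [] } rfl hu
    have h6 := run_drop .d { σ with
      p := x
      w := []
      q := encodeMarked Q
      f := []
      s := encodeNumber a ++ σ.s }
    refine (h1.seq (h2.seq ((Run.ite_false rfl h5).seq h6))).congr ?_ ?_
    · omega
    · rw [if_neg h]
      change { σ with p := _, q := _, w := _, f := _, s := _, d := σ.d.tail } = _
      rw [hd, List.tail_replicate]
      simp only [hw, hf, hq]

/-- Marking replaces single symbols, so the length of `Q` is constant and every round has the same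
scan cost. The final counters matter only through their bounds, for the cleanup. The word `x` below
`X` makes room for the closing bracket of the output. -/
theorem run_distributeAll (l : List ℕ) (c d : ℕ) (Q : List (ℕ × Γ')) (hQ : Marked Q)
    (S X : List ℕ) (x : List Γ')
    (σ : Stacks) (hp : σ.p = encodeWords l) (hq : σ.q = encodeMarked Q)
    (hw : σ.w = []) (hr : σ.r = []) (hu : σ.u = []) (hv : σ.v = []) (he : σ.e = []) (hf : σ.f = [])
    (hc : σ.c = List.replicate c .comma) (hd : σ.d = List.replicate d .comma)
    (hs : σ.s = encodeWords S) (ho : σ.o = encodeWords X ++ x) :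
    ∃ c' ≤ c, ∃ d' ≤ d, Marked (distribute l c d Q S X).1 ∧
      (encodeMarked (distribute l c d Q S X).1).length = (encodeMarked Q).length ∧
      Run distributeAll σ (40 * (l.length * (encodeMarked Q).length + (encodeWords l).length) + 1)
      { σ with
        p := []
        q := encodeMarked (distribute l c d Q S X).1
        c := List.replicate c' .comma
        d := List.replicate d' .comma
        s := encodeWords (distribute l c d Q S X).2.1
        o := encodeWords (distribute l c d Q S X).2.2 ++ x } := by
  induction l generalizing c d Q S X σ with
  | nil => 
    refine ⟨c, le_rfl, d, le_rfl, hQ, rfl, ?_⟩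
    change σ.p = [] at hp
    refine (Run.while_false (by change (σ.p).head?.isSome = _; rw [hp]; rfl)).congr
      (Nat.le_add_left _ _) ?_
    simp only [distribute, ← hp, ← hq, ← hc, ← hd, ← hs, ← ho]
  | cons a l ih =>
    have hpc : (σ.get .p).head?.isSome = true := by
      change σ.p.head?.isSome = true
      rw [hp]; exact isSome_head?_encodeWords_cons a l
    have h1 := run_distributeStep a c d Q hQ (encodeWords l) σ (hp.trans (encodeWords_cons a l)) hq
      hw hr hu hv he hf hc hd
    have hlen : (encodeWords (a :: l)).length =
        (encodeNat a).length + 1 + (encodeWords l).length := by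
      rw [encodeWords_cons]; simp; omega
    by_cases h : 0 < c ∧ a ∈ Q.map Prod.fst
    · rw [if_pos h] at h1
      obtain ⟨c', hc', d', hd', hm, hl, h2⟩ := ih (c - 1) (d - 1)
        (markWord (if 0 < d then .blank else .bra) a Q) (hQ.markWord (by split_ifs <;> rfl) a) S
        (a :: X) { σ with
          p := encodeWords l
          q := encodeMarked (markWord (if 0 < d then .blank else .bra) a Q)
          c := List.replicate (c - 1) .comma
          d := List.replicate (d - 1) .comma
          o := encodeNumber a ++ σ.o } rfl rfl hw hr hu hv he hf rfl rfl hs (by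
            simp [encodeWords, ho])
      rw [length_encodeMarked_markWord] at hl h2
      rw [distribute, if_pos h]
      refine ⟨c', by omega, d', by omega, hm, hl, ?_⟩
      refine (Run.while_true hpc h1 h2).congr ?_ rfl
      rw [hlen, List.length_cons, add_mul]
      omega
    · rw [if_neg h] at h1
      obtain ⟨c', hc', d', hd', hm, hl, h2⟩ := ih c (d - 1) Q hQ (a :: S) X { σ with
          p := encodeWords l
          d := List.replicate (d - 1) .comma
          s := encodeNumber a ++ σ.s } rfl hq hw hr hu hv he hf hc rfl (by
            simp [encodeWords, hs]) ho
      rw [distribute, if_neg h]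
      refine ⟨c', by omega, d', by omega, hm, hl, ?_⟩
      refine (Run.while_true hpc h1 h2).congr ?_ rfl
      rw [hlen, List.length_cons, add_mul]
      omega

/-! ### Testing for an inversion. -/

/-- Whether some bracket is preceded by a comma, or `b` holds and there is a bracket. -/
def inverted : Bool → List Γ' → Bool
  | _, [] => false
  | _, .comma :: l => inverted true l
  | b, .bra :: l => b || inverted b l
  | b, .blank :: l => inverted b l
  | b, .bit _ :: l => inverted b l
  | b, .ket :: l => inverted b l

theorem inverted_bits_append (b : Bool) (w : List Bool) (l : List Γ') :
    inverted b (w.map Γ'.bit ++ l) = inverted b l := by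
  induction w with
  | nil => rfl
  | cons a w ih => exact ih

/-- Bits are ignored, so the test can read the raw stack symbol by symbol without parsing words. -/
theorem inverted_encodeMarked (b : Bool) (l : List (ℕ × Γ')) :
    inverted b (encodeMarked l) = inverted b (l.map Prod.snd) := by
  induction l generalizing b with
  | nil => rfl
  | cons x l ih =>
    rw [encodeMarked_cons, inverted_bits_append, List.map_cons]
    rcases x with ⟨_, _ | _ | _ | _ | _⟩ <;> simp [inverted, ih]

/-- Set the flag `f` if on the stack `q` some bracket is below a comma. -/
def checkInverted : Prog Reg :=
  .while .q Option.isSome <| .pop .q fun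
    | some .comma => .push .e .comma
    | some .bra => .ite .e Option.isSome (.push .f .comma) .skip
    | _ => .skip

/-- The stack `e` remembers that a comma has been seen, and `f` that a bracket came later. Only
their emptiness carries information; the lengths are bounded for the cleanup. -/
theorem run_checkInverted (l : List Γ') (σ : Stacks) (hq : σ.q = l) :
    ∃ e f : List Γ', e.length ≤ σ.e.length + l.length ∧ f.length ≤ σ.f.length + l.length ∧
      (f.head?.isSome = (σ.f.head?.isSome || inverted σ.e.head?.isSome l)) ∧
      Run checkInverted σ (4 * l.length + 1) { σ with q := [], e := e, f := f } := by
  induction l generalizing σ with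
  | nil =>
    refine ⟨σ.e, σ.f, le_rfl, le_rfl, by simp [inverted], ?_⟩
    refine (Run.while_false (by change (σ.q).head?.isSome = _; rw [hq]; rfl)).congr
      (Nat.le_add_left _ _) ?_
    rw [← hq]
  | cons x l ih =>
    have hc : (σ.get .q).head?.isSome = true := by
      change σ.q.head?.isSome = true; rw [hq]; rfl
    have main : ∀ e₁ f₁ : List Γ', e₁.length ≤ σ.e.length + 1 → f₁.length ≤ σ.f.length + 1 →
        (f₁.head?.isSome || inverted e₁.head?.isSome l) =
          (σ.f.head?.isSome || inverted σ.e.head?.isSome (x :: l)) →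
        Run (.pop .q fun
          | some .comma => .push .e .comma
          | some .bra => .ite .e Option.isSome (.push .f .comma) .skip
          | _ => .skip) σ 3 { σ with q := l, e := e₁, f := f₁ } →
        ∃ e f : List Γ', e.length ≤ σ.e.length + (x :: l).length ∧
          f.length ≤ σ.f.length + (x :: l).length ∧
          (f.head?.isSome = (σ.f.head?.isSome || inverted σ.e.head?.isSome (x :: l))) ∧
          Run checkInverted σ (4 * (x :: l).length + 1) { σ with q := [], e := e, f := f } := by
      intro e₁ f₁ he₁ hf₁ h h1
      obtain ⟨e, f, he, hf, hef, h2⟩ := ih { σ with q := l, e := e₁, f := f₁ } rfl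
      dsimp only at he hf hef
      rw [List.length_cons]
      refine ⟨e, f, by omega, by omega, hef.trans h, (Run.while_true hc h1 h2).mono (by omega)⟩
    rcases x with _ | _ | _ | _ | _
    · exact main σ.e σ.f (by omega) (by omega) rfl
        ((Run.pop_cons (k := .q) (T := 1) hq (Run.skip _)).mono (by omega))
    · exact main σ.e σ.f (by omega) (by omega) rfl
        ((Run.pop_cons (k := .q) (T := 1) hq (Run.skip _)).mono (by omega))
    · by_cases he : σ.e.head?.isSome = true
      · exact main σ.e (.comma :: σ.f) (by omega) (by simp) (by simp [inverted, he])
          (Run.pop_cons (k := .q) hq (Run.ite_true he (Run.push _ _ _)))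
      · rw [Bool.not_eq_true] at he
        exact main σ.e σ.f (by omega) (by omega) (by simp [inverted, he])
          (Run.pop_cons (k := .q) hq (Run.ite_false he (Run.skip _)))
    · exact main σ.e σ.f (by omega) (by omega) rfl
        ((Run.pop_cons (k := .q) (T := 1) hq (Run.skip _)).mono (by omega))
    · exact main (.comma :: σ.e) σ.f (by simp) (by omega) rfl
        ((Run.pop_cons (k := .q) (T := 1) hq (Run.push _ _ _)).mono (by omega))

/-- Words are only moved, never created, which bounds the stacks `s` and `o`. -/
theorem length_distribute (l : List ℕ) (c d : ℕ) (Q : List (ℕ × Γ')) (S X : List ℕ) :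
    (encodeWords (distribute l c d Q S X).2.1).length +
      (encodeWords (distribute l c d Q S X).2.2).length =
    (encodeWords l).length + (encodeWords S).length + (encodeWords X).length := by
  induction l generalizing c d Q S X with
  | nil => simp [distribute, encodeWords]
  | cons a l ih =>
    rw [distribute]
    split_ifs <;> rw [ih] <;> simp [encodeWords] <;> omega

/-! ### The complete program and its running time. -/

/-- The answer that the program computes for `n` voters and `k`-approval. -/
def answer (n k : ℕ) (pref tie : List ℕ) : Option (List ℕ) :=
  if tie.length ≤ n * (pref.length - k) then none
  else
    -- The front has one outcome more than n(m-k). It is listed backwards, so a comma before a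
    -- bracket means that the bracketed outcome comes first in the tie-break order.
    let R := distribute pref.reverse (pref.length - k) (pref.length - k)
      ((tie.take (n * (pref.length - k) + 1)).reverse.map fun a => (a, .comma)) [] []
    if inverted false (R.1.map Prod.snd) then some (R.2.1 ++ R.2.2) else none

def clearAll : List Reg → Prog Reg
  | [] => .skip
  | k :: l => .seq (clear k) (clearAll l)

theorem run_clearAll (l : List Reg) (B : ℕ) (σ : Stacks) (h : ∀ k ∈ l, (σ.get k).length ≤ B) :
    Run (clearAll l) σ (l.length * (3 * B + 1) + 1) (l.foldl (fun σ k => σ.set k []) σ) := by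
  induction l generalizing σ with
  | nil => exact (Run.skip σ).mono (Nat.le_add_left _ _)
  | cons k l ih =>
    have h1 := run_clear k σ
    have h2 := ih (σ.set k []) fun k' hk' => by
      by_cases hkk : k' = k
      · subst hkk; simp
      · rw [Stacks.get_set_of_ne _ hkk]; exact h k' (List.mem_cons_of_mem _ hk')
    have := h k List.mem_cons_self
    exact (h1.seq h2).mono (by rw [List.length_cons, add_mul]; omega)

/-- Compute the answer when the front part of the tie-break order exists. -/
def solve : Prog Reg :=
  -- The first move supplies the extra word of the front. The closing bracket of the output goes to
  -- the bottom of `o`; the omitted outcomes come above it, and the approved ones are finally put on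
  -- top.
  .seq (moveWord .i .q) <| .seq (.push .o .ket) <| .seq distributeAll <| .seq checkInverted <|
  .ite .f Option.isSome (.seq (drain .s .u) (drain .u .o)) (clear .o)

def Stacks.empty : Stacks := ⟨[], [], [], [], [], [], [], [], [], [], [], [], [], [], []⟩

theorem run_solve (P T : List ℕ) (a : ℕ) (c : ℕ) (x y : List Γ') (N : ℕ)
    (hP : (encodeWords P).length ≤ N) (hP' : P.length ≤ N)
    (hT : (encodeWords (a :: T)).length ≤ N) :
    let R := distribute P c c ((a :: T).map fun a => (a, .comma)) [] []
    ∃ c' ≤ c, ∃ d' ≤ c, ∃ e f s : List Γ', e.length ≤ N ∧ f.length ≤ N ∧ s.length ≤ N ∧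
    Run solve
      { Stacks.empty with
        i := encodeNumber a ++ x
        p := encodeWords P
        n := y
        c := List.replicate c .comma
        d := List.replicate c .comma
        q := encodeWords T } (40 * N * N + 60 * N + 30)
      { Stacks.empty with
        i := x
        n := y
        c := List.replicate c' .comma
        d := List.replicate d' .comma
        e := e
        f := f
        s := s
        o := encodeAnswer (if inverted false (R.1.map Prod.snd) then some (R.2.1 ++ R.2.2)
          else none) } := by
  intro R
  have hQ : Marked ((a :: T).map fun a => (a, Γ'.comma)) := by
    intro y hy
    obtain ⟨_, _, rfl⟩ := List.mem_map.1 hy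
    rfl
  have h1 := run_moveWord (a := .i) (b := .q) (by decide) (by decide) (by decide) rfl
    (σ := { Stacks.empty with
        i := encodeNumber a ++ x
        p := encodeWords P
        n := y
        c := List.replicate c .comma
        d := List.replicate c .comma
        q := encodeWords T })
    (show encodeNumber a ++ x = (encodeNat a).map Γ'.bit ++ .comma :: x by
      simp [encodeNumber_eq]) rfl
  have h2 := Run.push { Stacks.empty with
        i := x
        p := encodeWords P
        n := y
        c := List.replicate c .comma
        d := List.replicate c .comma
        q := (encodeNat a).map Γ'.bit ++ .comma :: encodeWords T } .o .ket
  obtain ⟨c', hc', d', hd', -, hlen, h3⟩ := run_distributeAll P c c _ hQ [] [] [.ket]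
    { Stacks.empty with
        i := x
        p := encodeWords P
        n := y
        c := List.replicate c .comma
        d := List.replicate c .comma
        q := (encodeNat a).map Γ'.bit ++ .comma :: encodeWords T
        o := [.ket] } rfl
      ((encodeWords_cons a T).symm.trans (encodeMarked_comma _).symm) rfl rfl rfl rfl rfl rfl rfl
      rfl rfl rfl
  rw [encodeMarked_comma] at hlen h3
  have hSX := length_distribute P c c ((a :: T).map fun a => (a, Γ'.comma)) [] []
  change _ = _ + 0 + 0 at hSX
  change Run _ _ _ { Stacks.empty with
        i := x
        n := y
        c := List.replicate c' .comma
        d := List.replicate d' .comma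
        q := encodeMarked R.1
        s := encodeWords R.2.1
        o := encodeWords R.2.2 ++ [.ket] } at h3
  change (encodeMarked R.1).length = _ at hlen
  change (encodeWords R.2.1).length + (encodeWords R.2.2).length = _ at hSX
  clear_value R
  obtain ⟨e, f, he, hf, hef, h4⟩ := run_checkInverted _ { Stacks.empty with
        i := x
        n := y
        c := List.replicate c' .comma
        d := List.replicate d' .comma
        q := encodeMarked R.1
        s := encodeWords R.2.1
        o := encodeWords R.2.2 ++ [.ket] } rfl
  change e.length ≤ 0 + _ at he
  change f.length ≤ 0 + _ at hf
  change f.head?.isSome = (false || inverted false _) at hef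
  rw [Bool.false_or, inverted_encodeMarked] at hef
  rw [hlen] at he hf h4
  have hmul : P.length * (encodeWords (a :: T)).length ≤ N * N := Nat.mul_le_mul hP' hT
  have hTlen : (encodeWords (a :: T)).length =
      (encodeNat a).length + 1 + (encodeWords T).length := by
    rw [encodeWords_cons]; simp; omega
  have hnn : 40 * N * N = 40 * (N * N) := by ring
  by_cases hinv : inverted false (R.1.map Prod.snd) = true
  · refine ⟨c', hc', d', hd', e, f, [], by omega, by omega, Nat.zero_le _, ?_⟩
    have h5 := run_drain (a := .s) (b := .u) (by decide) { Stacks.empty with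
        i := x
        n := y
        c := List.replicate c' .comma
        d := List.replicate d' .comma
        e := e
        f := f
        s := encodeWords R.2.1
        o := encodeWords R.2.2 ++ [.ket] }
    have h6 := run_drain (a := .u) (b := .o) (by decide) { Stacks.empty with
        i := x
        n := y
        c := List.replicate c' .comma
        d := List.replicate d' .comma
        e := e
        f := f
        u := (encodeWords R.2.1).reverse ++ []
        o := encodeWords R.2.2 ++ [.ket] }
    refine (h1.seq (h2.seq (h3.seq (h4.seq (Run.ite_true (hef.trans hinv)
      (h5.seq h6)))))).congr ?_ ?_
    · simp only [Stacks.get, List.append_nil, List.length_reverse]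
      omega
    · rw [if_pos hinv]
      simp [Stacks.set, Stacks.get, Stacks.empty, encodeAnswer, encodeNumbers, encodeWords]
  · refine ⟨c', hc', d', hd', e, f, encodeWords R.2.1, by omega, by omega, by omega, ?_⟩
    have h5 := run_clear .o { Stacks.empty with
        i := x
        n := y
        c := List.replicate c' .comma
        d := List.replicate d' .comma
        e := e
        f := f
        s := encodeWords R.2.1
        o := encodeWords R.2.2 ++ [.ket] }
    refine (h1.seq (h2.seq (h3.seq (h4.seq (Run.ite_false (hef.trans (by simpa using hinv))
      h5))))).congr ?_ ?_
    · simp only [Stacks.get, List.length_append, List.length_singleton]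
      omega
    · rw [if_neg hinv]
      rfl

/-- The program that solves the obvious manipulation problem. -/
def main : Prog Reg :=
  -- The two dropped words are m, recovered as the length of the preference list, and the voter's
  -- index, which is irrelevant by anonymity.
  .seq (takeWord .i .n) <| .seq (dropWord .i) <| .seq (takeWord .i .b) <| .seq (dropWord .i) <|
  .seq readPref <| .seq (drop .i) <| .seq (.push .e .comma) <| .seq subtractApproved <|
  .seq (.push .e .comma) <| .seq takeFront <| .seq (.ite .i atKet .skip solve) <|
  clearAll [.i, .p, .n, .b, .c, .d, .q, .r, .w, .u, .v, .e, .f, .s]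

theorem run_afterFront (n k : ℕ) (P T : List ℕ) (y : List Γ') (N : ℕ)
    (hP : (encodeWords P).length ≤ N) (hP' : P.length ≤ N) (hy : y.length ≤ N)
    (hT : (encodeWords T).length + 1 ≤ N) :
    Run (.seq (.ite .i atKet .skip solve)
      (clearAll [.i, .p, .n, .b, .c, .d, .q, .r, .w, .u, .v, .e, .f, .s]))
      { Stacks.empty with
        i := encodeWords (T.drop (n * (P.length - k))) ++ [.ket]
        p := encodeWords P.reverse
        n := y
        c := List.replicate (P.length - k) .comma
        d := List.replicate (P.length - k) .comma
        q := encodeWords (T.take (n * (P.length - k))).reverse }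
      (40 * N * N + 102 * N + 60)
      { Stacks.empty with o := encodeAnswer (answer n k P T) } := by
  have hPr : (encodeWords P.reverse).length = (encodeWords P).length := by
    simp [encodeWords, List.length_flatMap]
  have hTd : (encodeWords (T.drop (n * (P.length - k)))).length +
      (encodeWords (T.take (n * (P.length - k))).reverse).length = (encodeWords T).length := by
    conv_rhs => rw [← List.take_append_drop (n * (P.length - k)) T, encodeWords_append]
    simp [encodeWords, List.length_flatMap, add_comm]
  by_cases h : T.length ≤ n * (P.length - k)
  · have h1 : T.drop (n * (P.length - k)) = [] := List.drop_eq_nil_of_le h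
    have h2 := run_clearAll [.i, .p, .n, .b, .c, .d, .q, .r, .w, .u, .v, .e, .f, .s] N
      { Stacks.empty with
        i := encodeWords (T.drop (n * (P.length - k))) ++ [.ket]
        p := encodeWords P.reverse
        n := y
        c := List.replicate (P.length - k) .comma
        d := List.replicate (P.length - k) .comma
        q := encodeWords (T.take (n * (P.length - k))).reverse } (by
        intro k hk
        cases k <;> simp only [Stacks.get, Stacks.empty, List.length_nil, List.length_append,
          List.length_replicate, List.length_singleton, Nat.zero_le] <;> omega)
    refine ((Run.ite_true (by
      change atKet (encodeWords _ ++ _).head? = true; rw [h1]; rfl) (Run.skip _)).seq h2).congr ?_ ?_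
    · simp only [List.length_cons, List.length_nil]
      nlinarith [Nat.zero_le (N * N)]
    · rw [answer, if_pos h]
      rfl
  -- A word is left on the input after n(m-k) have been taken; it completes the front.
  · obtain ⟨a, l, hal⟩ : ∃ a l, T.drop (n * (P.length - k)) = a :: l :=
      List.exists_cons_of_ne_nil (by simpa using h)
    have htake : (T.take (n * (P.length - k) + 1)).reverse =
        a :: (T.take (n * (P.length - k))).reverse := by
      rw [List.take_add, hal]; simp
    have hsplit : encodeWords (T.drop (n * (P.length - k))) ++ [.ket] =
        encodeNumber a ++ (encodeWords l ++ [.ket]) := by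
      rw [hal]; simp [encodeWords]
    have hl : (encodeWords (T.drop (n * (P.length - k)))).length =
        (encodeNumber a).length + (encodeWords l).length := by
      rw [hal]; simp [encodeWords]
    obtain ⟨c', hc', d', hd', e, f, s, he, hf, hs, h1⟩ := run_solve P.reverse
      (T.take (n * (P.length - k))).reverse a (P.length - k) (encodeWords l ++ [.ket]) y N
      (by omega) (by simpa using hP') (by
        change (encodeNumber a ++ encodeWords _).length ≤ N
        rw [List.length_append]; omega)
    have h2 := fun o => run_clearAll [.i, .p, .n, .b, .c, .d, .q, .r, .w, .u, .v, .e, .f, .s] N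
        { Stacks.empty with
        i := encodeWords l ++ [.ket]
        n := y
        c := List.replicate c' .comma
        d := List.replicate d' .comma
        e := e
        f := f
        s := s
        o := o } (by
        intro k hk
        cases k <;> simp only [Stacks.get, Stacks.empty, List.length_nil, List.length_append,
          List.length_replicate, List.length_singleton, Nat.zero_le] <;> first | omega | (simp at hk))
    rw [hsplit]
    refine ((Run.ite_false (by
      change atKet (encodeNumber a ++ _).head? = false
      rw [← hsplit, atKet_encodeWords, hal]; rfl) h1).seq (h2 _)).congr ?_ ?_
    · simp only [List.length_cons, List.length_nil]
      omega
    · rw [answer, if_neg h, List.map_congr_left (g := fun a => (a, Γ'.comma)) fun _ _ => rfl, htake]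
      rfl

theorem run_main (n m k v : ℕ) (P T : List ℕ) (hk : k < P.length) (w : List Γ')
    (hw : w = encodeNumber n ++ encodeNumber m ++ encodeNumber k ++ encodeNumber v ++
      encodeNumbers P ++ encodeNumbers T) :
    Run main { Stacks.empty with i := w } (200 * (w.length + 1) ^ 2)
      { Stacks.empty with o := encodeAnswer (answer n k P T) } := by
  have hlen : w.length = (encodeNat n).length + (encodeNat m).length + (encodeNat k).length +
      (encodeNat v).length + (encodeWords P).length + (encodeWords T).length + 6 := by
    rw [hw]; simp [encodeNumber_eq, encodeNumbers, encodeWords]; omega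
  have hPlen : ∀ l : List ℕ, l.length ≤ (encodeWords l).length := by
    intro l
    induction l with
    | nil => simp
    | cons a l ih => rw [encodeWords_cons]; simp; omega
  have h1 := run_takeWord (a := .i) (b := .n) (by decide) (by decide) (by decide)
    (t := .comma) rfl (σ := { Stacks.empty with i := w })
    (x := encodeNumber m ++ encodeNumber k ++ encodeNumber v ++ encodeNumbers P ++ encodeNumbers T)
    (show w = (encodeNat n).map Γ'.bit ++ _ by rw [hw]; simp [encodeNumber_eq]) rfl
  have h2 := run_dropWord (a := .i) (t := .comma) rfl (w := encodeNat m) (σ := { Stacks.empty with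
      i := encodeNumber m ++ encodeNumber k ++ encodeNumber v ++ encodeNumbers P ++ encodeNumbers T
      n := (encodeNat n).map Γ'.bit ++ [] })
    (x := encodeNumber k ++ encodeNumber v ++ encodeNumbers P ++ encodeNumbers T)
    (show encodeNumber m ++ _ ++ _ ++ _ ++ _ = _ by simp [encodeNumber_eq])
  have h3 := run_takeWord (a := .i) (b := .b) (by decide) (by decide) (by decide)
    (t := .comma) rfl (w := encodeNat k) (σ := { Stacks.empty with
      i := encodeNumber k ++ encodeNumber v ++ encodeNumbers P ++ encodeNumbers T
      n := (encodeNat n).map Γ'.bit ++ [] })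
    (x := encodeNumber v ++ encodeNumbers P ++ encodeNumbers T)
    (show encodeNumber k ++ _ ++ _ ++ _ = _ by simp [encodeNumber_eq]) rfl
  have h4 := run_dropWord (a := .i) (t := .comma) rfl (w := encodeNat v) (σ := { Stacks.empty with
      i := encodeNumber v ++ encodeNumbers P ++ encodeNumbers T
      n := (encodeNat n).map Γ'.bit ++ []
      b := (encodeNat k).map Γ'.bit ++ [] })
    (x := encodeNumbers P ++ encodeNumbers T)
    (show encodeNumber v ++ _ ++ _ = _ by simp [encodeNumber_eq])
  have h5 := run_readPref P (encodeNumbers T) { Stacks.empty with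
      i := encodeNumbers P ++ encodeNumbers T
      n := (encodeNat n).map Γ'.bit ++ []
      b := (encodeNat k).map Γ'.bit ++ [] } (by simp [encodeNumbers, encodeWords]) rfl
  have h6 := run_drop .i { Stacks.empty with
      i := .ket :: encodeNumbers T
      n := (encodeNat n).map Γ'.bit ++ []
      b := (encodeNat k).map Γ'.bit ++ []
      p := encodeWords P.reverse ++ []
      c := List.replicate P.length .comma ++ []
      d := List.replicate P.length .comma ++ [] }
  have h7 := Run.push { Stacks.empty with
      i := encodeNumbers T
      n := (encodeNat n).map Γ'.bit ++ []
      b := (encodeNat k).map Γ'.bit ++ []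
      p := encodeWords P.reverse ++ []
      c := List.replicate P.length .comma ++ []
      d := List.replicate P.length .comma ++ [] } .e .comma
  have h8 := run_subtractApproved (encodeNat k) P.length { Stacks.empty with
      i := encodeNumbers T
      n := (encodeNat n).map Γ'.bit ++ []
      b := (encodeNat k).map Γ'.bit ++ []
      p := encodeWords P.reverse ++ []
      c := List.replicate P.length .comma ++ []
      d := List.replicate P.length .comma ++ []
      e := [.comma] } (List.append_nil _) rfl rfl (List.append_nil _) (List.append_nil _)
  rw [bitsValue_encodeNat] at h8
  have h9 := Run.push { Stacks.empty with
      i := encodeNumbers T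
      n := (encodeNat n).map Γ'.bit ++ []
      p := encodeWords P.reverse ++ []
      c := List.replicate (P.length - k) .comma
      d := List.replicate (P.length - k) .comma } .e .comma
  obtain ⟨y, hy, h10⟩ := run_takeFront (P.length - k) (by omega) [] (encodeWords T).length T
    (encodeNat n) le_rfl { Stacks.empty with
      i := encodeNumbers T
      n := (encodeNat n).map Γ'.bit ++ []
      p := encodeWords P.reverse ++ []
      c := List.replicate (P.length - k) .comma
      d := List.replicate (P.length - k) .comma
      e := [.comma] } (List.append_nil _) rfl rfl rfl rfl rfl
  rw [bitsValue_encodeNat] at h10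
  have h11 := run_afterFront n k P T y w.length (by omega) ((hPlen P).trans (by omega)) (by omega)
    (by omega)
  have e1 : { Stacks.empty with
      i := encodeWords (T.drop (n * (P.length - k))) ++ [Γ'.ket]
      p := encodeWords P.reverse ++ []
      n := y
      c := List.replicate (P.length - k) .comma
      d := List.replicate (P.length - k) .comma
      q := encodeWords (T.take (n * (P.length - k))).reverse ++ [] } = { Stacks.empty with
      i := encodeWords (T.drop (n * (P.length - k))) ++ [Γ'.ket]
      p := encodeWords P.reverse
      n := y
      c := List.replicate (P.length - k) .comma
      d := List.replicate (P.length - k) .comma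
      q := encodeWords (T.take (n * (P.length - k))).reverse } := by
    simp only [List.append_nil]
  rw [← e1] at h11
  refine (h1.seq (h2.seq (h3.seq (h4.seq (h5.seq (h6.seq (h7.seq (h8.seq (h9.seq (h10.seq
    h11)))))))))).mono ?_
  -- The k+1 rounds of the subtraction are affordable because k < m and the input contains m words.
  have p1 : (k + 1) * (7 * (encodeNat k).length + 8) ≤ w.length * (7 * w.length + 8) :=
    Nat.mul_le_mul (by have := hPlen P; omega) (by omega)
  have p2 : (T.length + 1) * (7 * (encodeNat n).length + 8 * (P.length - k) +
      7 * (encodeWords T).length + 9) ≤ w.length * (8 * w.length + 9) :=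
    Nat.mul_le_mul (by have := hPlen T; omega) (by have := hPlen P; omega)
  nlinarith [p1, p2, hlen]

end StackProgram

/-! ### Which outcomes are reachable under a given report. -/

namespace ObviousManipulation

open Finset

/-- A demand that is met by `J.card` sets of `c` elements. -/
theorem exists_cover {ι α : Type*} [DecidableEq ι] [DecidableEq α] (J : Finset ι) (U : Finset α)
    (c : ℕ) (hc : c ≤ U.card) (e : α → ℕ) (he : ∀ d ∈ U, e d ≤ J.card)
    (hsum : ∑ d ∈ U, e d ≤ J.card * c) :
    ∃ B : ι → Finset α, (∀ j ∈ J, B j ⊆ U ∧ (B j).card = c) ∧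
      ∀ d ∈ U, e d ≤ (J.filter fun j => d ∈ B j).card := by
  induction J using Finset.induction_on generalizing e with
  | empty => exact ⟨fun _ => ∅, by simp, fun d hd => by simpa using he d hd⟩
  | insert j J hj ih =>
    rw [card_insert_of_notMem hj] at he hsum
    -- Elements whose demand equals the number of available sets must lie in every set; the bound on
    -- the sum leaves room for them.
    have hfull : (U.filter fun d => e d = J.card + 1).card ≤ c := by
      refine Nat.le_of_mul_le_mul_right (c := J.card + 1) ?_ (Nat.succ_pos _)
      calc _ = ∑ d ∈ U.filter (fun d => e d = J.card + 1), (J.card + 1) := by simp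
        _ = ∑ d ∈ U.filter (fun d => e d = J.card + 1), e d :=
          sum_congr rfl fun d hd => (mem_filter.1 hd).2.symm
        _ ≤ ∑ d ∈ U, e d := sum_le_sum_of_subset (filter_subset _ _)
        _ ≤ c * (J.card + 1) := by rw [mul_comm]; exact hsum
    have hfs : (U.filter fun d => e d = J.card + 1) ⊆ U.filter fun d => 0 < e d := by
      intro d hd
      rw [mem_filter] at hd ⊢
      exact ⟨hd.1, by omega⟩
    -- If at least c demands are positive, the new set is chosen among them and the total drops by
    -- exactly c. Otherwise it contains all of them and is padded; then fewer than c demands remain,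
    -- each at most `J.card`.
    obtain ⟨Bj, hBfull, hBU, hBc, hBsum⟩ : ∃ Bj : Finset α,
        (U.filter fun d => e d = J.card + 1) ⊆ Bj ∧ Bj ⊆ U ∧ Bj.card = c ∧
        ∑ d ∈ U, (e d - if d ∈ Bj then 1 else 0) ≤ J.card * c := by
      rcases le_or_gt c (U.filter fun d => 0 < e d).card with h | h
      · obtain ⟨Bj, h1, h2, h3⟩ := exists_subsuperset_card_eq hfs hfull h
        have hBU := h2.trans (filter_subset _ _)
        refine ⟨Bj, h1, hBU, h3, ?_⟩
        have h4 : ∑ d ∈ U, (e d - if d ∈ Bj then 1 else 0) + c = ∑ d ∈ U, e d := by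
          have h5 : c = ∑ d ∈ U, if d ∈ Bj then 1 else 0 := by
            rw [← sum_filter, filter_mem_eq_inter, inter_eq_right.2 hBU]
            simp [h3]
          rw [h5, ← sum_add_distrib]
          refine sum_congr rfl fun d _ => ?_
          split_ifs with hd
          · have := (mem_filter.1 (h2 hd)).2
            omega
          · omega
        rw [add_mul] at hsum
        omega
      · obtain ⟨Bj, h1, h2, h3⟩ := exists_subsuperset_card_eq (filter_subset _ _) h.le hc
        refine ⟨Bj, hfs.trans h1, h2, h3, ?_⟩
        calc _ ≤ ∑ d ∈ U, (if d ∈ U.filter (fun d => 0 < e d) then J.card else 0) := by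
              refine sum_le_sum fun d hd => ?_
              by_cases h0 : 0 < e d
              · have hm : d ∈ U.filter fun d => 0 < e d := mem_filter.2 ⟨hd, h0⟩
                rw [if_pos (h1 hm), if_pos hm]
                have := he d hd
                omega
              · omega
          _ = (U.filter fun d => 0 < e d).card * J.card := by
              rw [← sum_filter, filter_mem_eq_inter, inter_eq_right.2 (filter_subset _ _)]
              simp
          _ ≤ J.card * c := by rw [mul_comm]; exact Nat.mul_le_mul_left _ h.le
    obtain ⟨B, hB, hBe⟩ := ih (fun d => e d - if d ∈ Bj then 1 else 0) (fun d hd => by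
      have := he d hd
      split_ifs with hdB
      · omega
      · have : e d ≠ J.card + 1 := fun h => hdB (hBfull (mem_filter.2 ⟨hd, h⟩))
        omega) hBsum
    have hne : ∀ j' ∈ J, j' ≠ j := fun j' h h' => hj (h' ▸ h)
    refine ⟨Function.update B j Bj, ?_, fun d hd => ?_⟩
    · intro j' hj'
      rcases mem_insert.1 hj' with rfl | hj'
      · rw [Function.update_self]; exact ⟨hBU, hBc⟩
      · rw [Function.update_of_ne (hne j' hj')]; exact hB j' hj'
    · have h1 := hBe d hd
      have h2 : J.filter (fun j' => d ∈ Function.update B j Bj j') = J.filter fun j' => d ∈ B j' :=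
        filter_congr fun j' hj' => by rw [Function.update_of_ne (hne j' hj')]
      rw [filter_insert, Function.update_self, h2]
      split_ifs at h1 ⊢ with hdB
      · rw [card_insert_of_notMem (by simp [hj])]
        omega
      · omega

variable {n m : ℕ} [NeZero m]

/-- The outcomes that get a point from a voter who reports `r`. -/
def approved (k : ℕ) (r : Ranking m) : Finset (Fin m) := univ.filter fun o => (r.symm o).val < k

omit [NeZero m] in
theorem mem_approved {k : ℕ} {r : Ranking m} {o : Fin m} :
    o ∈ approved k r ↔ (r.symm o).val < k := by simp [approved]

omit [NeZero m] in
theorem card_position_lt (r : Ranking m) {k : ℕ} (hk : k ≤ m) :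
    (univ.filter fun o => (r.symm o).val < k).card = k := by
  have : (univ.filter fun o => (r.symm o).val < k) =
      (univ.filter fun j : Fin m => j.val < k).map r.toEmbedding := by
    ext o
    simp only [mem_filter, mem_univ, true_and, mem_map_equiv]
  rw [this, card_map, Fin.card_filter_val_lt, min_eq_right hk]

omit [NeZero m] in
theorem exists_ranking {k : ℕ} (hk : k ≤ m) (A : Finset (Fin m)) (hA : A.card = k) :
    ∃ r : Ranking m, approved k r = A := by
  have hc : Fintype.card {j : Fin m // j.val < k} = Fintype.card {o // o ∈ A} := by
    rw [Fintype.card_subtype, Fintype.card_coe, hA, Fin.card_filter_val_lt, min_eq_right hk]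
  obtain ⟨e⟩ := Fintype.card_eq.1 hc
  refine ⟨e.extendSubtype, ?_⟩
  ext o
  rw [mem_approved]
  constructor
  · intro h
    have := e.extendSubtype_mem _ h
    rwa [Equiv.apply_symm_apply] at this
  · intro h
    by_contra h'
    have := e.extendSubtype_not_mem _ h'
    rw [Equiv.apply_symm_apply] at this
    exact this h

theorem kApproval_eq_iff {k : ℕ} {L : Ranking m} {P : Fin n → Ranking m} {o : Fin m} :
    kApproval k L P = o ↔ ∀ d, score (fun j : Fin m => if j.val < k then 1 else 0) P d <
        score (fun j : Fin m => if j.val < k then 1 else 0) P o ∨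
      score (fun j : Fin m => if j.val < k then 1 else 0) P d =
        score (fun j : Fin m => if j.val < k then 1 else 0) P o ∧ L.symm o ≤ L.symm d := by
  set w : Fin m → ℕ := fun j => if j.val < k then 1 else 0
  have hne := (topScorers_nonempty w P).image L.symm
  have hdef : kApproval k L P = L (((topScorers w P).image L.symm).min' hne) := rfl
  obtain ⟨t, ht, hta⟩ := mem_image.1 (min'_mem _ hne)
  have htop : ∀ {o}, o ∈ topScorers w P ↔ ∀ o', score w P o' ≤ score w P o := by
    simp [topScorers]
  have hmin : ∀ d ∈ topScorers w P, L.symm t ≤ L.symm d := fun d hd => by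
    rw [hta]; exact min'_le _ _ (mem_image_of_mem _ hd)
  rw [hdef, ← hta, Equiv.apply_symm_apply]
  constructor
  · rintro rfl d
    rcases (htop.1 ht d).lt_or_eq with h | h
    · exact .inl h
    · exact .inr ⟨h, hmin d (htop.2 fun o' => h ▸ htop.1 ht o')⟩
  · intro h
    have ho : o ∈ topScorers w P := htop.2 fun o' => by
      rcases h o' with h | h
      exacts [h.le, h.1.le]
    rcases h t with h | h
    · exact absurd h (htop.1 ht o).not_gt
    · exact L.symm.injective (le_antisymm (hmin o ho) h.2)

omit [NeZero m] in
-- Counting the points withheld instead of those given turns winning into a covering problem; the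
-- additive form avoids truncated subtraction.
theorem score_update {k : ℕ} (P : Fin n → Ranking m) (i : Fin n) (r' : Ranking m) (d : Fin m) :
    score (fun j : Fin m => if j.val < k then 1 else 0) (Function.update P i r') d +
      ((univ.erase i).filter fun j => d ∉ approved k (P j)).card =
    (if d ∈ approved k r' then 1 else 0) + (n - 1) := by
  rw [score, ← add_sum_erase _ _ (mem_univ i), Function.update_self, add_assoc, card_filter,
    sum_congr rfl (g := fun j => if d ∈ approved k (P j) then 1 else 0) (fun j hj => by
      rw [Function.update_of_ne (ne_of_mem_erase hj)]; simp only [mem_approved]), ← sum_add_distrib]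
  congr 1
  · simp only [mem_approved]
  · rw [sum_congr rfl (g := fun _ => 1) fun j _ => by split_ifs <;> simp_all]
    simp

/-- An outcome is reachable iff the other voters can omit its competitors often enough. -/
theorem mem_reachable_iff {k : ℕ} (hn : 3 ≤ n) (hk : 0 < k) (hkm : k < m) (L : Ranking m)
    (i : Fin n) (r' : Ranking m) (o : Fin m) :
    o ∈ reachable (kApproval k L) i r' ↔
      ∑ d ∈ univ.erase o, ((if d ∈ approved k r' then 1 else 0) +
        (if L.symm d < L.symm o then 1 else 0) - (if o ∈ approved k r' then 1 else 0)) ≤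
      (n - 1) * (m - k) := by
  simp only [reachable, mem_image, mem_univ, true_and]
  constructor
  · rintro ⟨P, hP⟩
    rw [kApproval_eq_iff] at hP
    have htot : ∑ d, ((univ.erase i).filter fun j => d ∉ approved k (P j)).card =
        (n - 1) * (m - k) := by
      simp only [card_filter]
      rw [sum_comm, sum_congr rfl (g := fun _ => m - k)]
      · simp
      · intro j _
        rw [← card_filter, filter_not, card_sdiff_of_subset (filter_subset _ _)]
        simp only [mem_approved, card_position_lt _ hkm.le]
        simp
    rw [← htot]
    -- The winner forces each competitor to be omitted at least as often as demanded, and the total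
    -- number of omissions is fixed.
    refine (sum_le_sum fun d hd => ?_).trans (sum_le_sum_of_subset (erase_subset o univ))
    have h1 := score_update (k := k) P i r' d
    have h2 := score_update (k := k) P i r' o
    have hle : (L.symm d < L.symm o) → ¬ L.symm o ≤ L.symm d := fun h => h.not_ge
    have h3 := hP d
    by_cases hd : L.symm d < L.symm o
    · simp only [hle hd, and_false, or_false] at h3
      simp only [hd, if_true]
      omega
    · simp only [hd, if_false]
      omega
  · intro h
    have hcard : ((univ : Finset (Fin n)).erase i).card = n - 1 := by simp
    -- Every demand is at most 2 ≤ n-1; this uses n ≥ 3. The sets avoid o, so all the other voters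
    -- approve it.
    obtain ⟨B, hB, hBe⟩ := exists_cover ((univ : Finset (Fin n)).erase i) (univ.erase o) (m - k)
      (by simp; omega) _ (fun d _ => by
        rw [hcard]; split_ifs <;> omega) (hcard.symm ▸ h)
    have hA : ∀ j ∈ (univ : Finset (Fin n)).erase i, ((B j)ᶜ).card = k := fun j hj => by
      rw [card_compl, (hB j hj).2, Fintype.card_fin]; omega
    choose! P hP using fun (j : Fin n) (hj : j ∈ (univ : Finset (Fin n)).erase i) =>
      exists_ranking hkm.le _ (hA j hj)
    have hcount : ∀ d, ((univ.erase i).filter fun j => d ∉ approved k (P j)) =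
        (univ.erase i).filter fun j => d ∈ B j := fun d => filter_congr fun j hj => by
      rw [hP j hj, mem_compl, not_not]
    refine ⟨P, kApproval_eq_iff.2 fun d => ?_⟩
    by_cases hdo : d = o
    · subst hdo; exact .inr ⟨rfl, le_rfl⟩
    have h1 := score_update (k := k) P i r' d
    have h2 := score_update (k := k) P i r' o
    rw [hcount] at h1 h2
    have h3 : ((univ.erase i).filter fun j => o ∈ B j) = ∅ := by
      rw [filter_eq_empty_iff]
      intro j hj ho
      exact notMem_erase o _ ((hB j hj).1 ho)
    rw [h3, card_empty] at h2
    have h4 := hBe d (mem_erase.2 ⟨hdo, mem_univ _⟩)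
    by_cases hd : L.symm d < L.symm o
    · simp only [hd, if_true] at h4
      left
      omega
    · have hd' := not_lt.1 hd
      simp only [hd, if_false] at h4
      simp only [hd', and_true]
      omega

/-- When o itself has a point, a competitor's demand is 1 if it is approved and also ahead in the
tie-break order, and 0 otherwise. -/
theorem mem_reachable_of_mem {k : ℕ} (hn : 3 ≤ n) (hk : 0 < k) (hkm : k < m) (L : Ranking m)
    (i : Fin n) (r' : Ranking m) {o : Fin m} (ho : o ∈ approved k r') :
    o ∈ reachable (kApproval k L) i r' ↔
      ((approved k r').filter fun d => L.symm d < L.symm o).card ≤ (n - 1) * (m - k) := by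
  have h0 : ∀ d, (if d ∈ approved k r' ∧ L.symm d < L.symm o then 1 else 0) =
      (if d ∈ approved k r' then 1 else 0) + (if L.symm d < L.symm o then 1 else 0) - 1 := by
    intro d
    by_cases h : d ∈ approved k r' <;> by_cases h' : L.symm d < L.symm o <;> simp [h, h']
  rw [mem_reachable_iff hn hk hkm]
  simp only [ho, if_true, ← h0]
  rw [sum_erase _ (by simp), ← card_filter]
  simp only [approved, filter_filter, mem_filter, mem_univ, true_and]

/-- The demands add up to the k approved outcomes plus those ahead of o. The criterion does not
mention which outcomes the report approves. -/
theorem mem_reachable_of_notMem {k : ℕ} (hn : 3 ≤ n) (hk : 0 < k) (hkm : k < m) (L : Ranking m)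
    (i : Fin n) (r' : Ranking m) {o : Fin m} (ho : o ∉ approved k r') :
    o ∈ reachable (kApproval k L) i r' ↔ k + (L.symm o).val ≤ (n - 1) * (m - k) := by
  rw [mem_reachable_iff hn hk hkm]
  simp only [ho, if_false, Nat.sub_zero, sum_add_distrib]
  rw [sum_erase _ (by simp [ho]), sum_erase _ (by simp), ← card_filter, ← card_filter,
    filter_mem_eq_inter, univ_inter, approved, card_position_lt _ hkm.le,
    ← card_position_lt L (L.symm o).isLt.le]
  simp only [Fin.lt_def]

section Outcomes

omit [NeZero m]

variable (f : VotingRule n m) (i : Fin n) (r r' : Ranking m)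

theorem worstOutcome_mem : worstOutcome f i r r' ∈ reachable f i r' := by
  obtain ⟨o, ho, h⟩ := mem_image.1 (max'_mem _ ((reachable_nonempty f i r').image r.symm))
  rw [worstOutcome, ← h, Equiv.apply_symm_apply]
  exact ho

theorem bestOutcome_mem : bestOutcome f i r r' ∈ reachable f i r' := by
  obtain ⟨o, ho, h⟩ := mem_image.1 (min'_mem _ ((reachable_nonempty f i r').image r.symm))
  rw [bestOutcome, ← h, Equiv.apply_symm_apply]
  exact ho

variable {f i r'}

theorem le_worstOutcome {o : Fin m} (ho : o ∈ reachable f i r') :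
    r.symm o ≤ r.symm (worstOutcome f i r r') := by
  rw [worstOutcome, Equiv.symm_apply_apply]
  exact le_max' _ _ (mem_image_of_mem _ ho)

theorem bestOutcome_le {o : Fin m} (ho : o ∈ reachable f i r') :
    r.symm (bestOutcome f i r r') ≤ r.symm o := by
  rw [bestOutcome, Equiv.symm_apply_apply]
  exact min'_le _ _ (mem_image_of_mem _ ho)

end Outcomes

/-! ### When an obvious manipulation exists. -/

/-- With many voters there is no obvious manipulation. -/
theorem not_isObviousManipulation_of_le {k : ℕ} (hn : 3 ≤ n) (hk : 0 < k) (hkm : k < m)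
    (L : Ranking m) (i : Fin n) (r : Ranking m) (h : m ≤ n * (m - k)) (r' : Ranking m) :
    ¬ IsObviousManipulation (kApproval k L) i r r' := by
  have hD : k ≤ (n - 1) * (m - k) := by
    rw [Nat.sub_mul, one_mul]; omega
  have hmem : ∀ r' : Ranking m, ∀ o ∈ approved k r', o ∈ reachable (kApproval k L) i r' := by
    intro r' o ho
    rw [mem_reachable_of_mem hn hk hkm L i r' ho]
    exact (card_filter_le _ _).trans ((card_position_lt r' hkm.le).le.trans hD)
  rintro (hW | hB)
  · by_cases ho : worstOutcome (kApproval k L) i r r ∈ approved k r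
    -- Fewer than k outcomes are better than a truthfully approved one, so any k approved outcomes
    -- include one that is no better.
    · obtain ⟨d, hd, hdo⟩ : ∃ d ∈ approved k r',
          r.symm (worstOutcome (kApproval k L) i r r) ≤ r.symm d := by
        by_contra! hcon
        have hsub : approved k r' ⊆
            univ.filter fun d => (r.symm d).val < (r.symm (worstOutcome (kApproval k L) i r r)).val :=
          fun d hd => by simpa using hcon d hd
        have := card_le_card hsub
        rw [card_position_lt r (Fin.isLt _).le, approved, card_position_lt r' hkm.le] at this
        exact absurd (mem_approved.1 ho) (by omega)
      exact absurd (lt_of_lt_of_le hW hdo) (le_worstOutcome r (hmem r' d hd)).not_gt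
    · have h1 := worstOutcome_mem (kApproval k L) i r r
      have h2 : worstOutcome (kApproval k L) i r r ∈ reachable (kApproval k L) i r' := by
        by_cases h' : worstOutcome (kApproval k L) i r r ∈ approved k r'
        · exact hmem r' _ h'
        · rw [mem_reachable_of_notMem hn hk hkm L i r ho] at h1
          rwa [mem_reachable_of_notMem hn hk hkm L i r' h']
      exact absurd hW (le_worstOutcome r h2).not_gt
  · have h0 : r ⟨0, by omega⟩ ∈ approved k r := by
      rw [mem_approved, Equiv.symm_apply_apply]; exact hk
    have h1 := bestOutcome_le r (hmem r _ h0)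
    rw [Equiv.symm_apply_apply] at h1
    have h2 : r.symm (bestOutcome (kApproval k L) i r r') < r.symm (bestOutcome (kApproval k L) i r r) :=
      hB
    simp only [Fin.lt_def, Fin.le_def] at h1 h2
    omega

section FewVoters

variable {k : ℕ} {L : Ranking m}

/-- With few voters only approved outcomes are reachable. -/
theorem mem_reachable_iff_of_lt (hn : 3 ≤ n) (hk : 0 < k) (hkm : k < m) (h : n * (m - k) < m)
    (i : Fin n) (r' : Ranking m) (o : Fin m) :
    o ∈ reachable (kApproval k L) i r' ↔ o ∈ approved k r' ∧
      ((approved k r').filter fun d => L.symm d < L.symm o).card ≤ (n - 1) * (m - k) := by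
  by_cases ho : o ∈ approved k r'
  · rw [mem_reachable_of_mem hn hk hkm L i r' ho]; simp [ho]
  · rw [mem_reachable_of_notMem hn hk hkm L i r' ho]
    have : (n - 1) * (m - k) < k := by
      rw [Nat.sub_mul, one_mul]
      have : m - k ≤ n * (m - k) := Nat.le_mul_of_pos_left _ (by omega)
      omega
    simp only [ho, false_and, iff_false]
    omega

/-- Of the outcomes ahead of o, at most (n-1)(m-k) are approved by the report, and only m-k are
omitted. -/
theorem position_le_of_mem_reachable (hn : 3 ≤ n) (hk : 0 < k) (hkm : k < m)
    (h : n * (m - k) < m) {i : Fin n} {r' : Ranking m} {o : Fin m}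
    (ho : o ∈ reachable (kApproval k L) i r') : (L.symm o).val ≤ n * (m - k) := by
  obtain ⟨-, h2⟩ := (mem_reachable_iff_of_lt hn hk hkm h i r' o).1 ho
  have h3 : (univ.filter fun d => (L.symm d).val < (L.symm o).val) ⊆
      ((approved k r').filter fun d => L.symm d < L.symm o) ∪ (approved k r')ᶜ := by
    intro d hd
    simp only [mem_filter, mem_univ, true_and, mem_union, mem_compl] at hd ⊢
    by_cases hd' : d ∈ approved k r'
    · exact .inl ⟨hd', hd⟩
    · exact .inr hd'
  have h4 := (card_le_card h3).trans (card_union_le _ _)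
  rw [card_position_lt L (Fin.isLt _).le, card_compl, Fintype.card_fin, approved,
    card_position_lt r' hkm.le] at h4
  have : n * (m - k) = (n - 1) * (m - k) + (m - k) := by
    rw [Nat.sub_mul, one_mul, Nat.sub_add_cancel (Nat.le_mul_of_pos_left _ (by omega))]
  rw [approved] at h2
  omega

/-- The outcomes in the front part of the tie-break order. -/
def front (n k : ℕ) (L : Ranking m) : Finset (Fin m) :=
  univ.filter fun o => (L.symm o).val ≤ n * (m - k)

omit [NeZero m] in
theorem mem_front {o : Fin m} : o ∈ front n k L ↔ (L.symm o).val ≤ n * (m - k) := by simp [front]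

omit [NeZero m] in
theorem card_front (h : n * (m - k) < m) : (front n k L).card = n * (m - k) + 1 := by
  rw [← card_position_lt L (k := n * (m - k) + 1) h, front]
  simp only [Nat.lt_succ_iff]

/-- The set of the worst outcomes in the front part, which a manipulator omits. -/
structure IsOmission (n k : ℕ) (L r : Ranking m) (X : Finset (Fin m)) : Prop where
  subset : X ⊆ front n k L
  card : X.card = m - k
  lt : ∀ x ∈ X, ∀ y ∈ front n k L \ X, r.symm y < r.symm x

variable {r : Ranking m} {X : Finset (Fin m)}

omit [NeZero m] in
theorem IsOmission.card_sdiff (hX : IsOmission n k L r X) (hn : 3 ≤ n) (h : n * (m - k) < m) :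
    (front n k L \ X).card = (n - 1) * (m - k) + 1 := by
  rw [card_sdiff_of_subset hX.subset, card_front h, hX.card, Nat.sub_mul, one_mul]
  have : m - k ≤ n * (m - k) := Nat.le_mul_of_pos_left _ (by omega)
  omega

/-- Omitting X confines the result to the front outside X, whereas truth-telling can yield an
element of X, which is worse than all of these. -/
theorem isObviousManipulation_of_isOmission (hn : 3 ≤ n) (hk : 0 < k) (hkm : k < m)
    (h : n * (m - k) < m) (hX : IsOmission n k L r X)
    (hinv : ∃ x ∈ X, ∃ y ∈ front n k L \ X, (r.symm x).val < k ∧ L.symm x < L.symm y)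
    (i : Fin n) {r' : Ranking m} (hr' : approved k r' = Xᶜ) :
    IsObviousManipulation (kApproval k L) i r r' := by
  left
  obtain ⟨x₀, hx₀, y, hy, hx₀k, hxy⟩ := hinv
  -- With x first in the tie-break order, no other approved element of X precedes it. What does
  -- precede it lies in the front outside X and misses y, which is just few enough.
  obtain ⟨x, hx, hmin⟩ := exists_min_image (X ∩ approved k r) L.symm
    ⟨x₀, mem_inter.2 ⟨hx₀, mem_approved.2 hx₀k⟩⟩
  obtain ⟨hxX, hxr⟩ := mem_inter.1 hx
  have hxy' : L.symm x < L.symm y :=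
    (hmin x₀ (mem_inter.2 ⟨hx₀, mem_approved.2 hx₀k⟩)).trans_lt hxy
  have hxreach : x ∈ reachable (kApproval k L) i r := by
    rw [mem_reachable_iff_of_lt hn hk hkm h]
    refine ⟨hxr, ?_⟩
    have hsub : ((approved k r).filter fun d => L.symm d < L.symm x) ⊆
        (front n k L \ X).erase y := by
      intro d hd
      obtain ⟨hdr, hdx⟩ := mem_filter.1 hd
      refine mem_erase.2 ⟨?_, mem_sdiff.2 ⟨?_, ?_⟩⟩
      · rintro rfl
        exact lt_asymm hdx hxy'
      · have := mem_front.1 (hX.subset hxX)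
        exact mem_front.2 (by rw [Fin.lt_def] at hdx; omega)
      · intro hdX
        exact absurd hdx (hmin d (mem_inter.2 ⟨hdX, hdr⟩)).not_gt
    have := card_le_card hsub
    rw [card_erase_of_mem hy, hX.card_sdiff hn h] at this
    exact this
  have hW := worstOutcome_mem (kApproval k L) i r r'
  have hWX : worstOutcome (kApproval k L) i r r' ∈ front n k L \ X := by
    refine mem_sdiff.2 ⟨mem_front.2 (position_le_of_mem_reachable hn hk hkm h hW), ?_⟩
    have := ((mem_reachable_iff_of_lt hn hk hkm h i r' _).1 hW).1
    rw [hr'] at this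
    exact mem_compl.1 this
  exact lt_of_lt_of_le (hX.lt x hxX _ hWX) (le_worstOutcome r hxreach)

/-- Without an inversion, truth-telling already reaches exactly the front outside X, and no other
report has a better worst case or a better best case. -/
theorem not_isObviousManipulation_of_isOmission (hn : 3 ≤ n) (hk : 0 < k) (hkm : k < m)
    (h : n * (m - k) < m) (hX : IsOmission n k L r X)
    (hinv : ¬ ∃ x ∈ X, ∃ y ∈ front n k L \ X, (r.symm x).val < k ∧ L.symm x < L.symm y)
    (i : Fin n) (r' : Ranking m) :
    ¬ IsObviousManipulation (kApproval k L) i r r' := by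
  push Not at hinv
  have hcardX := hX.card_sdiff hn h
  have hsplit : n * (m - k) = (n - 1) * (m - k) + (m - k) := by
    rw [Nat.sub_mul, one_mul, Nat.sub_add_cancel (Nat.le_mul_of_pos_left _ (by omega))]
  -- All m-k elements of X are ranked below y, which puts y among the top k.
  have htop : ∀ y ∈ front n k L \ X, y ∈ approved k r := by
    intro y hy
    rw [mem_approved]
    have hsub : X ⊆ (univ.filter fun d => (r.symm d).val < (r.symm y).val + 1)ᶜ := by
      intro x hx
      have := hX.lt x hx y hy
      rw [Fin.lt_def] at this
      simp only [mem_compl, mem_filter, mem_univ, true_and]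
      omega
    have := card_le_card hsub
    rw [card_compl, card_position_lt r (Nat.succ_le_of_lt (Fin.isLt _)), hX.card,
      Fintype.card_fin] at this
    have := (r.symm y).isLt
    omega
  have hreach : reachable (kApproval k L) i r = front n k L \ X := by
    ext o
    rw [mem_reachable_iff_of_lt hn hk hkm h]
    constructor
    · intro ho
      have hof := mem_front.2 (position_le_of_mem_reachable hn hk hkm h
        ((mem_reachable_iff_of_lt hn hk hkm h i r o).2 ho))
      refine mem_sdiff.2 ⟨hof, fun hoX => ?_⟩
      -- An approved o in X would have all (n-1)(m-k)+1 outcomes of the front outside X ahead of it,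
      -- one too many.
      have hsub : front n k L \ X ⊆ (approved k r).filter fun d => L.symm d < L.symm o := by
        intro y hy
        refine mem_filter.2 ⟨htop y hy, (hinv o hoX y hy (mem_approved.1 ho.1)).lt_of_ne ?_⟩
        intro he
        exact (mem_sdiff.1 hy).2 (L.symm.injective he ▸ hoX)
      have := card_le_card hsub
      omega
    · intro hy
      refine ⟨htop o hy, ?_⟩
      have hsub : ((approved k r).filter fun d => L.symm d < L.symm o) ⊆
          (front n k L \ X).erase o := by
        intro d hd
        obtain ⟨hdr, hdo⟩ := mem_filter.1 hd
        refine mem_erase.2 ⟨?_, mem_sdiff.2 ⟨?_, fun hdX => ?_⟩⟩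
        · rintro rfl; exact lt_irrefl _ hdo
        · have := mem_front.1 (mem_sdiff.1 hy).1
          exact mem_front.2 (by rw [Fin.lt_def] at hdo; omega)
        · exact absurd hdo (hinv d hdX o hy (mem_approved.1 hdr)).not_gt
      have := card_le_card hsub
      rw [card_erase_of_mem hy] at this
      omega
  rintro (hW | hB)
  · have hwmem := worstOutcome_mem (kApproval k L) i r r
    set w := worstOutcome (kApproval k L) i r r
    rw [hreach] at hwmem
    have hbetter : ((front n k L).filter fun d => r.symm d < r.symm w).card ≤
        (n - 1) * (m - k) := by
      have hsub : ((front n k L).filter fun d => r.symm d < r.symm w) ⊆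
          (front n k L \ X).erase w := by
        intro d hd
        obtain ⟨hdf, hdw⟩ := mem_filter.1 hd
        refine mem_erase.2 ⟨?_, mem_sdiff.2 ⟨hdf, fun hdX => ?_⟩⟩
        · rintro rfl; exact lt_irrefl _ hdw
        · exact lt_asymm hdw (hX.lt d hdX w hwmem)
      have := card_le_card hsub
      rw [card_erase_of_mem hwmem] at this
      omega
    -- At most (n-1)(m-k) outcomes of the front beat w, and a report omits only m-k, so of the
    -- n(m-k)+1 outcomes at least one is approved and no better than w.
    have hex : ((approved k r' ∩ front n k L).filter fun d => ¬ r.symm d < r.symm w).Nonempty := by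
      rw [nonempty_iff_ne_empty]
      intro hempty
      rw [filter_eq_empty_iff] at hempty
      have hsub : front n k L ⊆
          ((front n k L).filter fun d => r.symm d < r.symm w) ∪ (approved k r')ᶜ := by
        intro d hd
        by_cases hdr : d ∈ approved k r'
        · exact mem_union_left _ (mem_filter.2
            ⟨hd, not_not.1 (hempty (mem_inter.2 ⟨hdr, hd⟩))⟩)
        · exact mem_union_right _ (mem_compl.2 hdr)
      have := (card_le_card hsub).trans (card_union_le _ _)
      rw [card_front h, card_compl, Fintype.card_fin, approved, card_position_lt r' hkm.le] at this
      omega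
    -- For z first in the tie-break order, all approved outcomes ahead of it beat w, so they are few
    -- enough for z to be reachable.
    obtain ⟨z, hz, hmin⟩ := exists_min_image _ L.symm hex
    obtain ⟨hzm, hzw⟩ := mem_filter.1 hz
    obtain ⟨hzr, hzf⟩ := mem_inter.1 hzm
    have hzreach : z ∈ reachable (kApproval k L) i r' := by
      rw [mem_reachable_iff_of_lt hn hk hkm h]
      refine ⟨hzr, le_trans (card_le_card ?_) hbetter⟩
      intro d hd
      obtain ⟨hdr, hdz⟩ := mem_filter.1 hd
      have hdf : d ∈ front n k L := by
        have := mem_front.1 hzf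
        exact mem_front.2 (by rw [Fin.lt_def] at hdz; omega)
      refine mem_filter.2 ⟨hdf, ?_⟩
      by_contra hdw
      exact absurd hdz (hmin d (mem_filter.2 ⟨mem_inter.2 ⟨hdr, hdf⟩, hdw⟩)).not_gt
    exact hzw ((le_worstOutcome r hzreach).trans_lt hW)
  · have hb := bestOutcome_mem (kApproval k L) i r r'
    have hbf := mem_front.2 (position_le_of_mem_reachable hn hk hkm h hb)
    have hb0 := bestOutcome_mem (kApproval k L) i r r
    by_cases hbX : bestOutcome (kApproval k L) i r r' ∈ X
    · rw [hreach] at hb0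
      exact lt_asymm hB (hX.lt _ hbX _ hb0)
    · exact absurd hB (bestOutcome_le r (hreach ▸ mem_sdiff.2 ⟨hbf, hbX⟩)).not_gt

end FewVoters

end ObviousManipulation

/-! ### Correctness of the computed answer. -/

namespace StackProgram

/-- Marks never change the words of `Q`, so membership is constant along the recursion. Distinctness
of `l` ensures that a mark, once set, is not overwritten by a later entry. -/
theorem distribute_spec (l : List ℕ) (hl : l.Nodup) (c d : ℕ) (Q : List (ℕ × Γ')) (S X : List ℕ) :
    (distribute l c d Q S X).2.2 = ((l.filter (· ∈ Q.map Prod.fst)).take c).reverse ++ X ∧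
    ((distribute l c d Q S X).2.1 ++ (distribute l c d Q S X).2.2).Perm (l ++ (S ++ X)) ∧
    (distribute l c d Q S X).1 = Q.map fun y => (y.1,
      if y.1 ∈ (l.filter (· ∈ Q.map Prod.fst)).take c then
        if y.1 ∈ l.take d then .blank else .bra
      else y.2) := by
  induction l generalizing c d Q S X with
  | nil => simp [distribute]
  | cons a l ih =>
    obtain ⟨ha, hl⟩ := List.nodup_cons.1 hl
    rw [distribute]
    by_cases h : 0 < c ∧ a ∈ Q.map Prod.fst
    · obtain ⟨c, rfl⟩ := Nat.exists_eq_succ_of_ne_zero h.1.ne'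
      rw [if_pos h]
      have hfst : (markWord (if 0 < d then Γ'.blank else Γ'.bra) a Q).map Prod.fst =
          Q.map Prod.fst := by
        simp [markWord, Function.comp_def]
      obtain ⟨h1, h2, h3⟩ := ih hl (c + 1 - 1) (d - 1)
        (markWord (if 0 < d then .blank else .bra) a Q) S (a :: X)
      rw [hfst] at h1 h3
      have hfilter : (a :: l).filter (· ∈ Q.map Prod.fst) = a :: l.filter (· ∈ Q.map Prod.fst) :=
        List.filter_cons_of_pos (by simpa using h.2)
      rw [hfilter, List.take_succ_cons]
      refine ⟨by rw [h1]; simp, h2.trans ?_, ?_⟩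
      · rw [← List.append_assoc, ← List.append_assoc]
        refine List.perm_middle.trans ?_
        simp
      · rw [h3, markWord, List.map_map]
        refine List.map_congr_left fun y _ => ?_
        simp only [Function.comp_apply, Nat.add_sub_cancel]
        by_cases hy : y.1 = a
        · have : a ∉ (l.filter (· ∈ Q.map Prod.fst)).take c := fun hm =>
            ha (List.mem_of_mem_filter (List.mem_of_mem_take hm))
          rw [hy, if_neg this, if_pos rfl, if_pos List.mem_cons_self]
          cases d <;> simp
        · rw [if_neg hy]
          cases d <;> simp [hy]
    · rw [if_neg h]
      obtain ⟨h1, h2, h3⟩ := ih hl c (d - 1) Q (a :: S) X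
      have hfilter : ((a :: l).filter (· ∈ Q.map Prod.fst)).take c =
          (l.filter (· ∈ Q.map Prod.fst)).take c := by
        by_cases hc : 0 < c
        · rw [List.filter_cons_of_neg]
          simpa using fun x hx => h ⟨hc, List.mem_map.2 ⟨_, hx, rfl⟩⟩
        · rw [Nat.eq_zero_of_not_pos hc, List.take_zero, List.take_zero]
      rw [hfilter]
      refine ⟨h1, h2.trans ?_, ?_⟩
      · rw [List.cons_append]; exact List.perm_middle
      · rw [h3]
        refine List.map_congr_left fun y hy => ?_
        by_cases hy' : y.1 ∈ (l.filter (· ∈ Q.map Prod.fst)).take c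
        · have hya : y.1 ≠ a := fun he =>
            ha (he ▸ List.mem_of_mem_filter (List.mem_of_mem_take hy'))
          rw [if_pos hy', if_pos hy']
          cases d <;> simp [hya]
        · rw [if_neg hy', if_neg hy']

theorem inverted_eq_false_iff (b : Bool) (l : List Γ') :
    inverted b l = false ↔ (b = true → .bra ∉ l) ∧
      l.Pairwise fun s t => ¬ (s = .comma ∧ t = .bra) := by
  induction l generalizing b with
  | nil => simp [inverted]
  | cons a l ih =>
    rcases a with _ | _ | _ | _ | _
    · simp [inverted, ih]
    · simp [inverted, ih]
    · simp [inverted, ih]; grind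
    · simp [inverted, ih]
    · simp [inverted, ih]; grind

end StackProgram

namespace ObviousManipulation

open StackProgram

theorem length_toList {m : ℕ} (r : Ranking m) : r.toList.length = m := by simp [Ranking.toList]

theorem getElem_toList {m : ℕ} (r : Ranking m) (j : ℕ) (hj : j < r.toList.length) :
    r.toList[j] = (r ⟨j, length_toList r ▸ hj⟩).val := by simp [Ranking.toList]

theorem nodup_toList {m : ℕ} (r : Ranking m) : r.toList.Nodup :=
  List.nodup_ofFn.2 (Fin.val_injective.comp r.injective)

theorem mem_toList {m : ℕ} (r : Ranking m) (a : ℕ) : a ∈ r.toList ↔ a < m := by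
  rw [Ranking.toList, List.mem_ofFn]
  exact ⟨fun ⟨j, hj⟩ => hj ▸ (r j).isLt, fun h => ⟨r.symm ⟨a, h⟩, by simp⟩⟩

theorem mem_take_toList {m : ℕ} (r : Ranking m) (j : ℕ) (o : Fin m) :
    o.val ∈ r.toList.take j ↔ (r.symm o).val < j := by
  rw [List.mem_take_iff_getElem]
  constructor
  · rintro ⟨i, hi, h⟩
    rw [getElem_toList, Fin.val_inj] at h
    rw [← h, Equiv.symm_apply_apply]
    exact (lt_min_iff.1 hi).1
  · intro h
    refine ⟨(r.symm o).val, lt_min h ?_, ?_⟩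
    · rw [length_toList]; exact Fin.isLt _
    · rw [getElem_toList]; simp

theorem mem_take_reverse_toList {m : ℕ} (r : Ranking m) (k : ℕ) (hk : k ≤ m) (o : Fin m) :
    o.val ∈ r.toList.reverse.take (m - k) ↔ k ≤ (r.symm o).val := by
  rw [List.take_reverse, List.mem_reverse, length_toList, Nat.sub_sub_self hk,
    ← not_lt, ← mem_take_toList]
  have h1 : o.val ∈ r.toList.take k ++ r.toList.drop k := by
    rw [List.take_append_drop, mem_toList]; exact o.isLt
  have h2 := nodup_toList r
  rw [← List.take_append_drop k r.toList] at h2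
  have h3 := List.disjoint_of_nodup_append h2
  exact ⟨fun h h' => h3 h' h, fun h => (List.mem_append.1 h1).resolve_left h⟩

theorem pairwise_toList {m : ℕ} (r : Ranking m) :
    r.toList.Pairwise fun a b => ∀ o o' : Fin m, o.val = a → o'.val = b → r.symm o < r.symm o' := by
  rw [List.pairwise_iff_getElem]
  intro i j hi hj hij o o' ho ho'
  rw [getElem_toList, Fin.val_inj] at ho ho'
  rw [ho, ho', Equiv.symm_apply_apply, Equiv.symm_apply_apply]
  exact hij

theorem exists_toList_eq {m : ℕ} (l : List ℕ) (hl : l.Nodup) (hlen : l.length = m)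
    (hlt : ∀ a ∈ l, a < m) : ∃ r : Ranking m, l = r.toList := by
  have hinj : Function.Injective fun j : Fin m =>
      (⟨l[j.val]'(hlen ▸ j.isLt), hlt _ (List.getElem_mem _)⟩ : Fin m) := by
    intro i j hij
    simp only [Fin.mk.injEq] at hij
    exact Fin.ext (hl.getElem_inj_iff.1 hij)
  refine ⟨Equiv.ofBijective _ (Finite.injective_iff_bijective.1 hinj), ?_⟩
  refine List.ext_getElem (by rw [length_toList, hlen]) fun j h1 h2 => ?_
  rw [getElem_toList]
  rfl

/-- The answer computed by the program is correct. -/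
theorem isAnswer_answer (x : OMInstance) :
    IsAnswer x (answer x.n x.k x.pref.toList x.tieBreak.toList) := by
  obtain ⟨n, m, k, hn, hm, hk, hkm, i, r, L⟩ := x
  have : NeZero m := ⟨by omega⟩
  simp only [answer, length_toList]
  by_cases hq : m ≤ n * (m - k)
  · rw [if_pos hq]
    exact not_isObviousManipulation_of_le hn hk hkm L i r hq
  rw [if_neg hq]
  rw [not_le] at hq
  set T := (L.toList.take (n * (m - k) + 1)).reverse with hT
  set F := r.toList.reverse.filter (· ∈ T) with hF
  have hfst : (T.map fun a => (a, Γ'.comma)).map Prod.fst = T := by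
    simp [Function.comp_def]
  obtain ⟨h1, h2, h3⟩ := distribute_spec r.toList.reverse (List.nodup_reverse.2 (nodup_toList r))
    (m - k) (m - k) (T.map fun a => (a, .comma)) [] []
  rw [hfst] at h1 h3
  rw [List.append_nil, ← hF] at h1
  rw [← hF] at h3
  rw [List.append_nil, List.append_nil] at h2
  set R := distribute r.toList.reverse (m - k) (m - k) (T.map fun a => (a, .comma)) [] []
  have hTfront : ∀ o : Fin m, o.val ∈ T ↔ o ∈ front n k L := by
    intro o
    rw [hT, List.mem_reverse, mem_take_toList, mem_front, Nat.lt_succ_iff]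
  have hTlt : ∀ a ∈ T, a < m := fun a ha => by
    rw [hT, List.mem_reverse] at ha
    exact (mem_toList L a).1 (List.mem_of_mem_take ha)
  have hTnodup : T.Nodup := List.nodup_reverse.2 ((nodup_toList L).take)
  have hFnodup : F.Nodup := (List.nodup_reverse.2 (nodup_toList r)).filter _
  have hFmem : ∀ a, a ∈ F ↔ a ∈ T := by
    intro a
    simp only [hF, List.mem_filter, List.mem_reverse, mem_toList, decide_eq_true_eq,
      and_iff_right_iff_imp]
    exact hTlt a
  have hFlen : F.length = n * (m - k) + 1 := by
    rw [((List.perm_ext_iff_of_nodup hFnodup hTnodup).2 hFmem).length_eq, hT, List.length_reverse,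
      List.length_take, length_toList]
    omega
  have hcle : m - k ≤ n * (m - k) := Nat.le_mul_of_pos_left _ (by omega)
  -- `F` lists the front from worst to best in the true preference, so its first m-k entries are the
  -- outcomes to omit.
  let X : Finset (Fin m) := Finset.univ.filter fun o => o.val ∈ F.take (m - k)
  have hXmem : ∀ o, o ∈ X ↔ o.val ∈ F.take (m - k) := by simp [X]
  have hX : IsOmission n k L r X := by
    refine ⟨?_, ?_, ?_⟩
    · intro o ho
      exact (hTfront o).1 ((hFmem _).1 (List.mem_of_mem_take ((hXmem o).1 ho)))
    · have : X.map Fin.valEmbedding = (F.take (m - k)).toFinset := by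
        ext a
        simp only [Finset.mem_map, hXmem, Fin.valEmbedding_apply, List.mem_toFinset]
        constructor
        · rintro ⟨o, ho, rfl⟩; exact ho
        · intro ha
          exact ⟨⟨a, hTlt a ((hFmem a).1 (List.mem_of_mem_take ha))⟩, ha, rfl⟩
      rw [← Finset.card_map Fin.valEmbedding, this,
        List.toFinset_card_of_nodup (hFnodup.take), List.length_take, hFlen]
      omega
    · intro o ho o' ho'
      obtain ⟨ho'f, ho'X⟩ := Finset.mem_sdiff.1 ho'
      have hpair : F.Pairwise fun a b => ∀ o o' : Fin m, o.val = a → o'.val = b →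
          r.symm o' < r.symm o := by
        refine List.Pairwise.filter _ (List.pairwise_reverse.2 ?_)
        exact (pairwise_toList r).imp fun h o o' ho ho' => h o' o ho' ho
      rw [← List.take_append_drop (m - k) F, List.pairwise_append] at hpair
      refine hpair.2.2 _ ((hXmem o).1 ho) o'.val ?_ o o' rfl rfl
      have hmem := (hFmem _).2 ((hTfront o').2 ho'f)
      rw [← List.take_append_drop (m - k) F, List.mem_append] at hmem
      exact hmem.resolve_left fun h => ho'X ((hXmem o').2 h)
  have hR1 : R.1.map Prod.snd = T.map fun a => if a ∈ F.take (m - k) then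
      if a ∈ r.toList.reverse.take (m - k) then .blank else .bra else .comma := by
    rw [h3]; simp [Function.comp_def]
  -- Commas belong to the front outside X and brackets to truthfully approved elements of X. Since
  -- `T` runs backwards through the tie-break order, a comma before a bracket is exactly an
  -- inversion.
  have hinv : inverted false (R.1.map Prod.snd) = true ↔
      ∃ x ∈ X, ∃ y ∈ front n k L \ X, (r.symm x).val < k ∧ L.symm x < L.symm y := by
    rw [← not_iff_not, Bool.not_eq_true, inverted_eq_false_iff, hR1, List.pairwise_map, hT,
      List.pairwise_reverse]
    simp only [Bool.false_eq_true, false_implies, true_and]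
    constructor
    · rintro hp ⟨x, hx, y, hy, hxk, hxy⟩
      obtain ⟨hyf, hyX⟩ := Finset.mem_sdiff.1 hy
      have hyT := mem_front.1 hyf
      rw [List.pairwise_iff_getElem] at hp
      have hlen : (L.toList.take (n * (m - k) + 1)).length = n * (m - k) + 1 := by
        rw [List.length_take, length_toList]; omega
      have := hp (L.symm x).val (L.symm y).val (by rw [hlen, Fin.lt_def] at *; omega) (by omega) hxy
      simp only [List.getElem_take, getElem_toList, Fin.eta, Equiv.apply_symm_apply] at this
      rw [hXmem] at hx hyX
      rw [if_pos hx, if_neg hyX, if_neg (by rw [mem_take_reverse_toList r k hkm.le]; omega)] at this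
      simp at this
    · intro hne
      rw [List.pairwise_iff_getElem]
      intro a b ha hb hab
      rw [List.length_take, length_toList] at ha hb
      rintro ⟨hy, hx⟩
      simp only [List.getElem_take, getElem_toList] at hx hy
      refine hne ⟨L ⟨a, by omega⟩, ?_, L ⟨b, by omega⟩, ?_, ?_, ?_⟩
      · rw [hXmem]
        by_contra hcon
        rw [if_neg hcon] at hx
        simp at hx
      · refine Finset.mem_sdiff.2 ⟨mem_front.2 (by rw [Equiv.symm_apply_apply]; dsimp only; omega), fun hcon => ?_⟩
        rw [hXmem] at hcon
        rw [if_pos hcon] at hy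
        split_ifs at hy
      · rw [← not_le, ← mem_take_reverse_toList r k hkm.le]
        intro hcon
        rw [if_pos hcon] at hx
        split_ifs at hx
      · rw [Equiv.symm_apply_apply, Equiv.symm_apply_apply]
        exact hab
  by_cases hI : inverted false (R.1.map Prod.snd) = true
  · rw [if_pos hI]
    have hnodup : (R.2.1 ++ R.2.2).Nodup :=
      h2.nodup_iff.2 (List.nodup_reverse.2 (nodup_toList r))
    have hlen : (R.2.1 ++ R.2.2).length = m := by
      rw [h2.length_eq, List.length_reverse, length_toList]
    obtain ⟨r', hr'⟩ := exists_toList_eq (R.2.1 ++ R.2.2) hnodup hlen fun a ha => by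
      rw [h2.mem_iff, List.mem_reverse, mem_toList] at ha
      exact ha
    refine ⟨r', hr', isObviousManipulation_of_isOmission hn hk hkm hq hX (hinv.1 hI) i ?_⟩
    -- The omitted outcomes fill the last m-k places of the output, so the ranking it describes
    -- approves exactly the complement of X.
    have hlen2 : R.2.2.length = m - k := by
      rw [h1, List.length_reverse, List.length_take, hFlen]; omega
    have hlen1 : R.2.1.length = k := by
      rw [List.length_append, hlen2] at hlen
      clear * - hlen hkm
      omega
    have hm2 (o : Fin m) : o.val ∈ R.2.2 ↔ o.val ∈ F.take (m - k) := by
      rw [h1, List.mem_reverse]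
    ext o
    rw [mem_approved, ← mem_take_toList, ← hr', List.take_left' hlen1, Finset.mem_compl, hXmem,
      ← hm2]
    have hmem : o.val ∈ R.2.1 ++ R.2.2 := by rw [hr', mem_toList]; exact o.isLt
    exact ⟨fun h h' => List.disjoint_of_nodup_append hnodup h h',
      fun h => (List.mem_append.1 hmem).resolve_right h⟩
  · rw [if_neg hI]
    exact not_isObviousManipulation_of_isOmission hn hk hkm hq hX (fun h => hI (hinv.2 h)) i

end ObviousManipulation

open StackProgram in
theorem mainTheorem8 :
    ∃ A : ObviousManipulation.OMInstance → Option (List ℕ),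
      (∀ x : ObviousManipulation.OMInstance, ObviousManipulation.IsAnswer x (A x)) ∧
      Nonempty (Turing.TM2ComputableInPolyTime
        ObviousManipulation.encodeInstance ObviousManipulation.encodeAnswer A) := by
  refine ⟨fun x => answer x.n x.k x.pref.toList x.tieBreak.toList,
    ObviousManipulation.isAnswer_answer, ?_⟩
  refine nonempty_tm2ComputableInPolyTime main .i .o _ _ _
    (200 * (Polynomial.X + 1) ^ 2 + 1) fun x => ?_
  obtain ⟨t, ht, hexec⟩ := run_main x.n x.m x.k x.voter.val x.pref.toList x.tieBreak.toList
    (by rw [ObviousManipulation.length_toList]; exact x.k_lt_m) _ rfl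
  refine ⟨t, ?_, ?_⟩
  · simp only [Polynomial.eval_add, Polynomial.eval_mul, Polynomial.eval_pow, Polynomial.eval_X,
      Polynomial.eval_one, Polynomial.eval_ofNat]
    exact Nat.succ_le_succ ht
  · convert hexec using 1 <;>
    · funext k
      cases k <;> rfl
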